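/- Let $K$ be a field, $r\ge 0$, $\mathbb N=\{0,1,2,\dots\}$, and let $R=\bigoplus_{d\in\mathbb N^r}R_d$ be a commutative multigraded $K$-algebra of finite type, i.e. $R$ is finitely generated as a $K$-algebra and $R_0$ is a finite-dimensional $K$-vector space. Let $M=\bigoplus_{d\in\mathbb Z^r}M_d$ be a finitely generated multigraded $R$-module. For $t=(t_1,\dots,t_r)$ write $t^d=t_1^{d_1}\cdots t_r^{d_r}$. For a multigraded submodule $N\subseteq M$ let $H(N,t)=\sum_{d\in\mathbb Z^r}\dim_K(N_d)\,t^d$ be its Hilbert series. The universal denominator $\operatorname{udenom}(M,t)$ is the smallest polynomial $B(t)\in\mathbb Z[t_1,\dots,t_r]$ (with respect to divisibility) such that $B(0)=1$ and $B(t)H(N,t)$ is a Laurent polynomial for every multigraded submodule $N\subseteq M$. For $k\in\mathbb N$ let $\phi_k(t)\in\mathbb Z[t]$ be the polynomial in one variable with $\phi_k(0)=1$ that equals the $k$-th cyclotomic polynomial up to sign (and $\phi_0=1$). For $d=(d_1,\dots,d_r)\in\mathbb N^r$ put $\phi_d(t)=\phi_k(t^{d/k})$ with $k=\gcd(d_1,\dots,d_r)$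 if $d\neq 0$, and $\phi_0(t)=1$ for $d=0$. Say that $d$ divides $e$ in $\mathbb N^r$ if $e=kd$ for some $k\in\mathbb N$, and let $I^{[d]}\subseteq R$ be the ideal generated by all $R_e$ for which $d$ does not divide $e$. Let $m_d$ be the dimension of the support of $M/I^{[d]}M$ in $\operatorname{Spec}R$ (with $m_d=0$ for all $d$ if $M=0$). Then $\operatorname{udenom}(M,t)$ exists, each $m_d$ is finite, only finitely many $m_d$ are nonzero, and: (a) $\displaystyle \operatorname{udenom}(M,t)=\prod_{d\in\mathbb N^r}\phi_d(t)^{m_d}.$ (b) $\operatorname{udenom}(M,t)$ is the greatest common divisor in $\mathbb Z[t_1,\dots,t_r]$ of all products $(1-t^{d_1})(1-t^{d_2})\cdots(1-t^{d_s})$, $s\ge 0$, for which there exist homogeneous $f_1,\dots,f_s\in R$ of degrees $d_1,\dots,d_s\in\mathbb N^r$ respectively such that $M$ is a finitely generated $K[f_1,\dots,f_s]$-module. -/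

import Mathlib

namespace UnivDenom

noncomputable section

/-- The monomial `t^d = t₁^{d₁} ⋯ t_r^{d_r}`. -/
def tpow {r : ℕ} (d : Fin r → ℕ) : MvPolynomial (Fin r) ℤ :=
  ∏ i, MvPolynomial.X i ^ d i

/-- The polynomial `φ_k(t) ∈ ℤ[t]` with constant term `1` whose zeros are the primitive `k`-th roots
of unity: the cyclotomic polynomial, with its sign changed for `k = 1`. There are no primitive
`0`-th roots of unity, and `φ_0 = 1`. -/
def phi (k : ℕ) : Polynomial ℤ :=
  if k = 1 then 1 - Polynomial.X else Polynomial.cyclotomic k ℤ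

/-- `φ_d(t) = φ_k(t^{d/k})` for `d ∈ ℕ^r`, where `k = gcd(d₁, …, d_r)`. -/
def phiVec {r : ℕ} (d : Fin r → ℕ) : MvPolynomial (Fin r) ℤ :=
  Polynomial.aeval (tpow fun i => d i / Finset.univ.gcd d) (phi (Finset.univ.gcd d))

/-- Divisibility in `ℕ^r`: `d` divides `e` if `e = k d` for some `k ∈ ℕ`. -/
def VecDvd {r : ℕ} (d e : Fin r → ℕ) : Prop :=
  ∃ k : ℕ, e = k • d

/-- A formal Laurent series with integer coefficients, given by its coefficients. -/
abbrev FormalLaurent (r : ℕ) : Type :=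
  (Fin r → ℤ) → ℤ

/-- The product of a polynomial and a formal Laurent series:
the coefficient of `t^e` is `∑ₐ Bₐ H_{e-a}`. -/
def polyMul {r : ℕ} (B : MvPolynomial (Fin r) ℤ) (H : FormalLaurent r) : FormalLaurent r :=
  fun e => ∑ a ∈ B.support, B.coeff a * H (fun i => e i - (a i : ℤ))

/-- A formal Laurent series is a Laurent polynomial if only finitely many of its coefficients are
nonzero. -/
def IsLaurentPolynomial {r : ℕ} (H : FormalLaurent r) : Prop :=
  (Function.support H).Finite

section Module

variable {K R M : Type*} [Field K] [CommRing R] [Algebra K R] [AddCommGroup M] [Module K M]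
  [Module R M] [IsScalarTower K R M] {r : ℕ}

/-- The Hilbert series `∑_d dim_K(N ∩ M_d) t^d` of a graded submodule `N` of `M`. -/
def hilbertSeries (ℳ : (Fin r → ℤ) → Submodule K M) (N : Submodule R M) : FormalLaurent r :=
  fun d => (Module.finrank K ↥(N.restrictScalars K ⊓ ℳ d) : ℤ)

/-- `B(0) = 1`, and `B(t) H(N,t)` is a Laurent polynomial for every graded submodule `N` of `M`. -/
def IsCommonDenominator (R : Type*) [CommRing R] [Algebra K R] [Module R M] [IsScalarTower K R M]
    (ℳ : (Fin r → ℤ) → Submodule K M) [DirectSum.Decomposition ℳ]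
    (B : MvPolynomial (Fin r) ℤ) : Prop :=
  MvPolynomial.constantCoeff B = 1 ∧
    ∀ N : Submodule R M, N.IsHomogeneous ℳ →
      IsLaurentPolynomial (polyMul B (hilbertSeries ℳ N))

/-- `B` is a smallest (with respect to divisibility) polynomial with `B(0) = 1` such that
`B(t) H(N,t)` is a Laurent polynomial for every graded submodule `N` of `M`. -/
def IsUniversalDenominator (R : Type*) [CommRing R] [Algebra K R] [Module R M]
    [IsScalarTower K R M] (ℳ : (Fin r → ℤ) → Submodule K M) [DirectSum.Decomposition ℳ]
    (B : MvPolynomial (Fin r) ℤ) : Prop :=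
  IsCommonDenominator R ℳ B ∧ ∀ B', IsCommonDenominator R ℳ B' → B ∣ B'

open Classical in
/-- The universal denominator of the graded `R`-module `M` (`0` if there is none). -/
def udenom (R : Type*) [CommRing R] [Algebra K R] [Module R M] [IsScalarTower K R M]
    (ℳ : (Fin r → ℤ) → Submodule K M) [DirectSum.Decomposition ℳ] : MvPolynomial (Fin r) ℤ :=
  if h : ∃ B, IsUniversalDenominator R ℳ B then h.choose else 0

/-- The ideal `I^{[d]}` generated by all `R_e` such that `d` does not divide `e`. -/
def idealI (𝒜 : (Fin r → ℕ) → Submodule K R) (d : Fin r → ℕ) : Ideal R :=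
  Ideal.span {x | ∃ e, ¬ VecDvd d e ∧ x ∈ 𝒜 e}

/-- The dimension of the support of `M / I^{[d]} M`, in `{-∞, 0, 1, 2, …, ∞}`. -/
def suppDim (𝒜 : (Fin r → ℕ) → Submodule K R) (M : Type*) [AddCommGroup M] [Module R M]
    (d : Fin r → ℕ) : WithBot ℕ∞ :=
  Module.supportDim R (M ⧸ (idealI 𝒜 d • (⊤ : Submodule R M)))

/-- The exponent `m_d`: the dimension of the support of `M / I^{[d]} M` as a natural number,
where the dimension of the empty support is counted as `0`. -/
def mult (𝒜 : (Fin r → ℕ) → Submodule K R) (M : Type*) [AddCommGroup M] [Module R M]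
    (d : Fin r → ℕ) : ℕ :=
  ((suppDim 𝒜 M d).unbotD 0).toNat

/-- The set of all products `(1 - t^{d₁}) ⋯ (1 - t^{d_s})` such that `M` is a finitely generated
`K[f₁, …, f_s]`-module for some homogeneous `f₁, …, f_s ∈ R` of degrees `d₁, …, d_s`. -/
def parameterProducts (𝒜 : (Fin r → ℕ) → Submodule K R) (M : Type*) [AddCommGroup M]
    [Module R M] : Set (MvPolynomial (Fin r) ℤ) :=
  {p | ∃ (s : ℕ) (f : Fin s → R) (δ : Fin s → Fin r → ℕ),
    (∀ i, f i ∈ 𝒜 (δ i)) ∧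
    Module.Finite ↥(Algebra.adjoin K (Set.range f)) M ∧
    p = ∏ i, (1 - tpow (δ i))}

end Module

end

end UnivDenom

/-!
Call `B` a common denominator if `B(0) = 1` and `B(t) H(N,t)` is a Laurent polynomial for all `N`.

*Upper bound.* If `M` is finite over `K[f₁, …, f_s]`, then `∏ (1 - t^{deg f_i})` is a common
denominator (Hilbert–Serre), and it is a product of `φ_d`'s in which `φ_e` occurs once for every `i`
such that `e` divides `deg f_i`. Graded prime avoidance modulo `I^{[e]}` gives, for each `e`, such a
system in which at most `m_e` of the degrees are divisible by `e`. The `φ_d` are pairwise relatively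
prime, so the greatest common divisor of finitely many of these products is still a common
denominator, and it divides `∏ φ_e^{m_e}`.

*Lower bound.* For each `e` there is a homogeneous `x ∈ M` such that `R x / I^{[e]} x` has dimension
at least `m_e`. This module lives in the degrees `deg x + ℕ e`, and its dimensions along this ray
grow so fast that its Hilbert series has a pole of order at least `m_e` at the primitive roots of
unity cut out by `φ_e`. As the series is the difference of `H(R x, t)` and `H(I^{[e]} x, t)`, every
common denominator is divisible by `φ_e^{m_e}`.
-/

namespace UnivDenom

section Monomials

open MvPolynomial

variable {r : ℕ}

theorem tpow_eq_monomial (d : Fin r → ℕ) :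
    tpow d = monomial (Finsupp.equivFunOnFinite.symm d) 1 := by
  rw [tpow, monomial_eq, Finsupp.prod_fintype] <;> simp

theorem tpow_add (d e : Fin r → ℕ) : tpow (d + e) = tpow d * tpow e := by
  simp [tpow, pow_add, Finset.prod_mul_distrib]

theorem tpow_nsmul (k : ℕ) (d : Fin r → ℕ) : tpow (k • d) = tpow d ^ k := by
  simp [tpow, ← Finset.prod_pow, ← pow_mul, mul_comm]

theorem tpow_injective : Function.Injective (tpow (r := r)) := by
  intro d e h
  rw [tpow_eq_monomial, tpow_eq_monomial] at h
  exact Finsupp.equivFunOnFinite.symm.injective (monomial_left_injective one_ne_zero h)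

theorem constantCoeff_tpow {d : Fin r → ℕ} (hd : d ≠ 0) : constantCoeff (tpow d) = 0 := by
  obtain ⟨i, hi⟩ := Function.ne_iff.mp hd
  rw [tpow, map_prod]
  exact Finset.prod_eq_zero (Finset.mem_univ i) (by simpa using hi)

theorem degreeOf_tpow (d : Fin r → ℕ) (i : Fin r) : degreeOf i (tpow d) = d i := by
  rw [tpow_eq_monomial, degreeOf_monomial_eq _ _ one_ne_zero,
    Finsupp.equivFunOnFinite_symm_apply_apply]

theorem constantCoeff_one_sub_tpow {d : Fin r → ℕ} (hd : d ≠ 0) :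
    constantCoeff (1 - tpow d) = 1 := by
  rw [map_sub, map_one, constantCoeff_tpow hd, sub_zero]

theorem one_sub_tpow_ne_zero {d : Fin r → ℕ} (hd : d ≠ 0) : 1 - tpow d ≠ 0 := fun h => by
  simpa [h] using constantCoeff_one_sub_tpow hd

theorem constantCoeff_aeval_tpow {d : Fin r → ℕ} (hd : d ≠ 0) (p : Polynomial ℤ) :
    constantCoeff (Polynomial.aeval (tpow d) p) = p.coeff 0 := by
  rw [Polynomial.aeval_def, Polynomial.hom_eval₂, constantCoeff_tpow hd,
    Polynomial.eval₂_at_zero]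
  simp

theorem one_sub_tpow_dvd (k : ℕ) (d : Fin r → ℕ) : 1 - tpow d ∣ 1 - tpow (k • d) := by
  rw [tpow_nsmul]
  exact one_sub_dvd_one_sub_pow (tpow d) k

end Monomials

section RelPrime

open MvPolynomial

theorem dvd_of_dvd_mul_of_isRelPrime {α : Type*} [CommMonoidWithZero α] [IsCancelMulZero α]
    [DecompositionMonoid α] {a b c g : α} (hab : IsRelPrime a b) (ha : c ∣ g * a)
    (hb : c ∣ g * b) : c ∣ g := by
  obtain ⟨x, y, ⟨z, rfl⟩, hya, rfl⟩ := exists_dvd_and_dvd_of_dvd_mul ha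
  obtain rfl | hx := eq_or_ne x 0
  · simp
  · rw [mul_assoc, mul_dvd_mul_iff_left hx] at hb
    exact mul_dvd_mul_left x ((hab.of_dvd_left hya).dvd_of_dvd_mul_right hb)

theorem dvd_sub_of_dvd_one_sub_mul {A : Type*} [CommRing A] {c u v w : A} (hu : c ∣ 1 - w * u)
    (hv : c ∣ 1 - w * v) : c ∣ u - v := by
  have key : u - v = u * (1 - w * v) - v * (1 - w * u) := by ring
  exact key ▸ dvd_sub (hv.mul_left u) (hu.mul_left v)

variable {σ A : Type*} [CommRing A] [IsDomain A]

theorem eq_of_dvd_of_dvd_of_constantCoeff {p q : MvPolynomial σ A} (hp : constantCoeff p = 1)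
    (hq : constantCoeff q = 1) (hpq : p ∣ q) (hqp : q ∣ p) : p = q := by
  obtain ⟨u, rfl⟩ := associated_of_dvd_dvd hpq hqp
  obtain ⟨a, -, ha⟩ := isUnit_iff_eq_C_of_isReduced.mp u.isUnit
  rw [map_mul, hp, one_mul, ha, constantCoeff_C] at hq
  rw [ha, hq, C_1, mul_one]

theorem isUnit_of_dvd_of_degreeOf_eq_zero {p c : MvPolynomial σ A}
    (hp : IsUnit (constantCoeff p)) (hc : c ∣ p) (h : ∀ i, degreeOf i c = 0) : IsUnit c := by
  classical
  rw [isUnit_iff_totalDegree_of_isReduced]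
  refine ⟨isUnit_of_dvd_unit (map_dvd constantCoeff hc) hp, ?_⟩
  have : c.degrees = 0 := Multiset.eq_zero_of_forall_notMem fun i hi =>
    Multiset.count_ne_zero.mpr hi (by simpa only [degreeOf_def] using h i)
  exact Nat.le_zero.mp ((totalDegree_le_degrees_card c).trans (by simp [this]))

theorem degreeOf_eq_zero_of_dvd {i : σ} {c q : MvPolynomial σ A} (hq : q ≠ 0)
    (h : c ∣ q) (hi : degreeOf i q = 0) : degreeOf i c = 0 := by
  obtain ⟨b, rfl⟩ := h
  rw [degreeOf_mul_eq (left_ne_zero_of_mul hq) (right_ne_zero_of_mul hq)] at hi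
  exact (Nat.add_eq_zero_iff.mp hi).1

theorem isRelPrime_of_elimination {p q : MvPolynomial σ A} (hp : IsUnit (constantCoeff p))
    (h : ∀ i, ∃ g, g ≠ 0 ∧ degreeOf i g = 0 ∧ ∀ c, c ∣ p → c ∣ q → c ∣ g) : IsRelPrime p q := by
  refine fun c hcp hcq => isUnit_of_dvd_of_degreeOf_eq_zero hp hcp fun i => ?_
  obtain ⟨g, hg, hgi, hc⟩ := h i
  exact degreeOf_eq_zero_of_dvd hg (hc c hcp hcq) hgi

theorem isRelPrime_of_mul_add_mul_eq_C {p q a b : MvPolynomial σ A} {n : A}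
    (hp : IsUnit (constantCoeff p)) (hn : n ≠ 0) (h : a * p + b * q = C n) : IsRelPrime p q :=
  isRelPrime_of_elimination hp fun i => ⟨C n, by simpa using hn, degreeOf_C n i, fun c hcp hcq =>
    h ▸ dvd_add (hcp.mul_left a) (hcq.mul_left b)⟩

theorem isRelPrime_tpow {r : ℕ} {p : MvPolynomial (Fin r) ℤ} (hp : constantCoeff p = 1)
    (d : Fin r → ℕ) : IsRelPrime p (tpow d) := by
  refine IsRelPrime.prod_right fun i _ => IsRelPrime.pow_right ?_
  refine ((X_prime (R := ℤ) (i := i)).irreducible.isRelPrime_iff_not_dvd.mpr ?_).symm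
  rintro ⟨g, rfl⟩
  simp at hp

theorem degreeOf_one_sub_tpow {r : ℕ} {d : Fin r → ℕ} {i : Fin r} (hi : d i = 0) :
    degreeOf i (1 - tpow d) = 0 := by
  simpa [degreeOf_tpow, hi] using degreeOf_sub_le i 1 (tpow d)

theorem single_add_update_zero {ι : Type*} [DecidableEq ι] (d : ι → ℕ) (i : ι) :
    Pi.single i (d i) + Function.update d i 0 = d := by
  ext j
  obtain rfl | hj := eq_or_ne j i
  · simp
  · simp [hj]

theorem dvd_tpow_update_sub_tpow_update {r : ℕ} {d e : Fin r → ℕ} {i : Fin r}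
    (hi : d i = e i) {c : MvPolynomial (Fin r) ℤ} (hd : c ∣ 1 - tpow d) (he : c ∣ 1 - tpow e) :
    c ∣ tpow (Function.update d i 0) - tpow (Function.update e i 0) := by
  rw [← single_add_update_zero d i, tpow_add] at hd
  rw [← single_add_update_zero e i, tpow_add, ← hi] at he
  exact dvd_sub_of_dvd_one_sub_mul hd he

theorem isRelPrime_one_sub_tpow {r : ℕ} {d e : Fin r → ℕ} (hd : d ≠ 0) (he : e ≠ 0)
    (h : ∀ a b : ℕ, a ≠ 0 → b ≠ 0 → a • d ≠ b • e) : IsRelPrime (1 - tpow d) (1 - tpow e) := by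
  refine isRelPrime_of_elimination (by simp [constantCoeff_tpow hd]) fun i => ?_
  by_cases hdi : d i = 0
  · exact ⟨_, one_sub_tpow_ne_zero hd, degreeOf_one_sub_tpow hdi, fun _ h _ => h⟩
  by_cases hei : e i = 0
  · exact ⟨_, one_sub_tpow_ne_zero he, degreeOf_one_sub_tpow hei, fun _ _ h => h⟩
  have hi : (e i • d) i = (d i • e) i := mul_comm _ _
  refine ⟨tpow (Function.update (e i • d) i 0) - tpow (Function.update (d i • e) i 0),
    fun h0 => h (e i) (d i) hei hdi ?_, ?_, fun c hcd hce => dvd_tpow_update_sub_tpow_update hi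
      (hcd.trans (one_sub_tpow_dvd _ d)) (hce.trans (one_sub_tpow_dvd _ e))⟩
  · rw [← single_add_update_zero (e i • d) i, tpow_injective (sub_eq_zero.mp h0), hi,
      single_add_update_zero]
  · refine Nat.le_zero.mp ((degreeOf_sub_le i _ _).trans ?_)
    simp [degreeOf_tpow]

end RelPrime

section Phi

open MvPolynomial

theorem phi_zero : phi 0 = 1 := by simp [phi]

theorem phi_coeff_zero (k : ℕ) : (phi k).coeff 0 = 1 := by
  rcases lt_trichotomy k 1 with hk | rfl | hk
  · simp [Nat.lt_one_iff.mp hk, phi_zero]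
  · simp [phi]
  · simpa [phi, hk.ne'] using Polynomial.cyclotomic_coeff_zero ℤ hk

theorem phi_associated_cyclotomic (k : ℕ) :
    Associated (phi k) (Polynomial.cyclotomic k ℤ) := by
  obtain rfl | hk := eq_or_ne k 1
  · rw [phi, if_pos rfl, Polynomial.cyclotomic_one, ← neg_sub]
    exact (Associated.refl _).neg_left
  · rw [phi, if_neg hk]

theorem prod_phi {n : ℕ} (hn : 0 < n) : ∏ k ∈ n.divisors, phi k = 1 - Polynomial.X ^ n := by
  have h1 : 1 ∈ n.divisors := Nat.one_mem_divisors.mpr hn.ne'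
  have herase : ∏ k ∈ n.divisors.erase 1, phi k =
      ∏ k ∈ n.divisors.erase 1, Polynomial.cyclotomic k ℤ :=
    Finset.prod_congr rfl fun k hk => if_neg (Finset.ne_of_mem_erase hk)
  rw [← neg_sub, ← Polynomial.prod_cyclotomic_eq_X_pow_sub_one hn ℤ,
    ← Finset.mul_prod_erase _ _ h1, ← Finset.mul_prod_erase _ _ h1, herase, phi, if_pos rfl,
    Polynomial.cyclotomic_one]
  ring

theorem exists_mul_add_mul_eq_C_of_isCoprime_map {A F : Type*} [CommRing A] [IsDomain A]
    [Field F] [Algebra A F] [IsFractionRing A F] {p q : Polynomial A}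
    (h : IsCoprime (p.map (algebraMap A F)) (q.map (algebraMap A F))) :
    ∃ (a b : Polynomial A) (n : A), n ≠ 0 ∧ a * p + b * q = Polynomial.C n := by
  obtain ⟨a, b, hab⟩ := h
  obtain ⟨m, hm0, hm⟩ := IsLocalization.integerNormalization_spec (nonZeroDivisors A) a
  obtain ⟨n, hn0, hn⟩ := IsLocalization.integerNormalization_spec (nonZeroDivisors A) b
  refine ⟨Polynomial.C n * IsLocalization.integerNormalization (nonZeroDivisors A) a,
    Polynomial.C m * IsLocalization.integerNormalization (nonZeroDivisors A) b, m * n,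
    mul_ne_zero (nonZeroDivisors.ne_zero hm0) (nonZeroDivisors.ne_zero hn0),
    Polynomial.map_injective (algebraMap A F) (IsFractionRing.injective A F) ?_⟩
  simp only [Polynomial.map_add, Polynomial.map_mul, Polynomial.map_C, hm, hn, map_mul,
    Algebra.smul_def, Polynomial.algebraMap_apply]
  linear_combination
    Polynomial.C (algebraMap A F m) * Polynomial.C (algebraMap A F n) * hab

theorem exists_mul_phi_add_mul_phi_eq_C {k l : ℕ} (h : k ≠ l) :
    ∃ (a b : Polynomial ℤ) (n : ℤ), n ≠ 0 ∧ a * phi k + b * phi l = Polynomial.C n := by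
  have hdvd (j : ℕ) : (phi j).map (algebraMap ℤ ℚ) ∣ Polynomial.cyclotomic j ℚ := by
    simpa using map_dvd (Polynomial.mapRingHom (algebraMap ℤ ℚ)) (phi_associated_cyclotomic j).dvd
  exact exists_mul_add_mul_eq_C_of_isCoprime_map
    (((Polynomial.cyclotomic.isCoprime_rat h).of_isCoprime_of_dvd_left
      (hdvd k)).of_isCoprime_of_dvd_right (hdvd l))

section Gcd

variable {ι : Type*} [Fintype ι]

theorem univ_gcd_nsmul (k : ℕ) (u : ι → ℕ) :
    Finset.univ.gcd (k • u) = k * Finset.univ.gcd u :=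
  Finset.gcd_mul_left.trans (by rw [normalize_eq])

theorem univ_gcd_zero : Finset.univ.gcd (0 : ι → ℕ) = 0 :=
  Finset.gcd_eq_zero_iff.mpr fun _ _ => rfl

theorem univ_gcd_ne_zero {d : ι → ℕ} (hd : d ≠ 0) : Finset.univ.gcd d ≠ 0 := fun h =>
  hd (funext fun i => Finset.gcd_eq_zero_iff.mp h i (Finset.mem_univ i))

/-- The primitive vector `d / gcd(d)`, with the junk value `0` for `d = 0`. -/
def primitivePart (d : ι → ℕ) : ι → ℕ := fun i => d i / Finset.univ.gcd d

theorem gcd_nsmul_primitivePart (d : ι → ℕ) : Finset.univ.gcd d • primitivePart d = d :=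
  funext fun i => Nat.mul_div_cancel' (Finset.gcd_dvd (Finset.mem_univ i))

theorem gcd_primitivePart {d : ι → ℕ} (hd : d ≠ 0) : Finset.univ.gcd (primitivePart d) = 1 := by
  obtain ⟨i, hi⟩ := Function.ne_iff.mp hd
  exact Finset.gcd_div_eq_one (Finset.mem_univ i) hi

theorem primitivePart_nsmul {u : ι → ℕ} (hu : Finset.univ.gcd u = 1) {k : ℕ} (hk : k ≠ 0) :
    primitivePart (k • u) = u := by
  ext i
  rw [primitivePart, univ_gcd_nsmul, hu, mul_one]
  exact Nat.mul_div_cancel_left _ (Nat.pos_of_ne_zero hk)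

theorem primitivePart_ne_zero {d : ι → ℕ} (hd : d ≠ 0) : primitivePart d ≠ 0 := fun h => by
  simpa [h, univ_gcd_zero] using gcd_primitivePart hd

theorem primitivePart_eq_of_nsmul_eq_nsmul {d e : ι → ℕ} (hd : d ≠ 0) (he : e ≠ 0) {a b : ℕ}
    (ha : a ≠ 0) (hb : b ≠ 0) (h : a • d = b • e) : primitivePart d = primitivePart e := by
  rw [← gcd_nsmul_primitivePart d, ← gcd_nsmul_primitivePart e, smul_smul, smul_smul] at h
  rw [← primitivePart_nsmul (gcd_primitivePart hd) (mul_ne_zero ha (univ_gcd_ne_zero hd)), h,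
    primitivePart_nsmul (gcd_primitivePart he) (mul_ne_zero hb (univ_gcd_ne_zero he))]

end Gcd

variable {r : ℕ}

theorem phiVec_eq_aeval (d : Fin r → ℕ) :
    phiVec d = Polynomial.aeval (tpow (primitivePart d)) (phi (Finset.univ.gcd d)) := rfl

theorem phiVec_zero : phiVec (0 : Fin r → ℕ) = 1 := by
  rw [phiVec_eq_aeval, univ_gcd_zero, phi_zero, map_one]

theorem phiVec_nsmul {u : Fin r → ℕ} (hu : Finset.univ.gcd u = 1) {k : ℕ} (hk : k ≠ 0) :
    phiVec (k • u) = Polynomial.aeval (tpow u) (phi k) := by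
  rw [phiVec_eq_aeval, primitivePart_nsmul hu hk, univ_gcd_nsmul, hu, mul_one]

theorem constantCoeff_phiVec (d : Fin r → ℕ) : constantCoeff (phiVec d) = 1 := by
  obtain rfl | hd := eq_or_ne d 0
  · rw [phiVec_zero, map_one]
  · rw [phiVec_eq_aeval, constantCoeff_aeval_tpow (primitivePart_ne_zero hd), phi_coeff_zero]

theorem prod_phiVec {d : Fin r → ℕ} (hd : d ≠ 0) :
    ∏ k ∈ (Finset.univ.gcd d).divisors, phiVec (k • primitivePart d) = 1 - tpow d := by
  rw [Finset.prod_congr rfl fun k hk =>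
      phiVec_nsmul (gcd_primitivePart hd) (Nat.pos_of_mem_divisors hk).ne', ← map_prod,
    prod_phi (Nat.pos_of_ne_zero (univ_gcd_ne_zero hd)), map_sub, map_one, map_pow,
    Polynomial.aeval_X, ← tpow_nsmul, gcd_nsmul_primitivePart]

theorem phiVec_dvd_one_sub_tpow {d : Fin r → ℕ} (hd : d ≠ 0) : phiVec d ∣ 1 - tpow d := by
  have := Finset.dvd_prod_of_mem (fun k => phiVec (k • primitivePart d))
    (Nat.mem_divisors_self _ (univ_gcd_ne_zero hd))
  rwa [gcd_nsmul_primitivePart, prod_phiVec hd] at this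

theorem isRelPrime_phiVec_of_primitivePart_eq {d e : Fin r → ℕ} (h : d ≠ e)
    (hde : primitivePart d = primitivePart e) : IsRelPrime (phiVec d) (phiVec e) := by
  have hgcd : Finset.univ.gcd d ≠ Finset.univ.gcd e := fun hgcd => h <| by
    rw [← gcd_nsmul_primitivePart d, ← gcd_nsmul_primitivePart e, hde, hgcd]
  obtain ⟨a, b, n, hn, hab⟩ := exists_mul_phi_add_mul_phi_eq_C hgcd
  refine isRelPrime_of_mul_add_mul_eq_C (by simp [constantCoeff_phiVec]) hn
    (a := Polynomial.aeval (tpow (primitivePart d)) a)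
    (b := Polynomial.aeval (tpow (primitivePart d)) b) ?_
  rw [phiVec_eq_aeval, phiVec_eq_aeval, ← hde, ← map_mul, ← map_mul, ← map_add, hab]
  simp

theorem isRelPrime_phiVec {d e : Fin r → ℕ} (h : d ≠ e) : IsRelPrime (phiVec d) (phiVec e) := by
  by_cases hde : primitivePart d = primitivePart e
  · exact isRelPrime_phiVec_of_primitivePart_eq h hde
  obtain rfl | hd := eq_or_ne d 0
  · exact phiVec_zero (r := r) ▸ isRelPrime_one_left
  obtain rfl | he := eq_or_ne e 0
  · exact phiVec_zero (r := r) ▸ isRelPrime_one_right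
  have hrel : IsRelPrime (1 - tpow d) (1 - tpow e) := isRelPrime_one_sub_tpow hd he
    fun a b ha hb hab => hde (primitivePart_eq_of_nsmul_eq_nsmul hd he ha hb hab)
  exact (hrel.of_dvd_left (phiVec_dvd_one_sub_tpow hd)).of_dvd_right (phiVec_dvd_one_sub_tpow he)

end Phi

section PhiProd

open MvPolynomial

variable {r : ℕ}

/-- The product `∏_d φ_d(t)^{n_d}`, for exponents `n_d` almost all of which vanish. -/
noncomputable def phiProd (n : (Fin r → ℕ) →₀ ℕ) : MvPolynomial (Fin r) ℤ :=
  n.prod fun d m => phiVec d ^ m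

theorem phiProd_add (n n' : (Fin r → ℕ) →₀ ℕ) : phiProd (n + n') = phiProd n * phiProd n' :=
  Finsupp.prod_add_index' (fun _ => pow_zero _) fun _ _ _ => pow_add _ _ _

theorem phiProd_sum {ι : Type*} (s : Finset ι) (n : ι → (Fin r → ℕ) →₀ ℕ) :
    phiProd (∑ i ∈ s, n i) = ∏ i ∈ s, phiProd (n i) :=
  (Finsupp.prod_finsetSum_index (fun _ => pow_zero _) fun _ _ _ => pow_add _ _ _).symm

theorem phiProd_single (d : Fin r → ℕ) : phiProd (Finsupp.single d 1) = phiVec d := by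
  simp [phiProd]

theorem constantCoeff_phiProd (n : (Fin r → ℕ) →₀ ℕ) : constantCoeff (phiProd n) = 1 := by
  simp [phiProd, Finsupp.prod, map_prod, constantCoeff_phiVec]

theorem phiProd_ne_zero (n : (Fin r → ℕ) →₀ ℕ) : phiProd n ≠ 0 := fun h => by
  simpa [h] using constantCoeff_phiProd n

theorem phiProd_dvd_phiProd {n n' : (Fin r → ℕ) →₀ ℕ} (h : n ≤ n') : phiProd n ∣ phiProd n' := by
  rw [← add_tsub_cancel_of_le h, phiProd_add]
  exact dvd_mul_right _ _

theorem phiProd_dvd_of_forall {n : (Fin r → ℕ) →₀ ℕ} {p : MvPolynomial (Fin r) ℤ}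
    (h : ∀ d, phiVec d ^ n d ∣ p) : phiProd n ∣ p :=
  Finset.prod_dvd_of_isRelPrime (fun _ _ _ _ hde => (isRelPrime_phiVec hde).pow)
    fun d _ => h d

theorem isRelPrime_phiProd {n n' : (Fin r → ℕ) →₀ ℕ} (h : n ⊓ n' = 0) :
    IsRelPrime (phiProd n) (phiProd n') := by
  refine IsRelPrime.prod_left fun d hd => IsRelPrime.prod_right fun e he =>
    IsRelPrime.pow (isRelPrime_phiVec ?_)
  rintro rfl
  have h0 : min (n d) (n' d) = 0 := DFunLike.congr_fun h d
  rcases Nat.min_eq_zero_iff.mp h0 with h0 | h0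
  · exact Finsupp.mem_support_iff.mp hd h0
  · exact Finsupp.mem_support_iff.mp he h0

theorem isRelPrime_phiProd_sub_inf (n n' : (Fin r → ℕ) →₀ ℕ) :
    IsRelPrime (phiProd (n - n ⊓ n')) (phiProd (n' - n ⊓ n')) := by
  refine isRelPrime_phiProd (Finsupp.ext fun d => ?_)
  simp only [Finsupp.inf_apply, Finsupp.coe_tsub, Pi.sub_apply, Finsupp.coe_zero, Pi.zero_apply]
  omega

theorem phiProd_eq_inf_mul_left (n n' : (Fin r → ℕ) →₀ ℕ) :
    phiProd n = phiProd (n ⊓ n') * phiProd (n - n ⊓ n') := by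
  rw [← phiProd_add, add_tsub_cancel_of_le inf_le_left]

theorem phiProd_eq_inf_mul_right (n n' : (Fin r → ℕ) →₀ ℕ) :
    phiProd n' = phiProd (n ⊓ n') * phiProd (n' - n ⊓ n') := by
  rw [← phiProd_add, add_tsub_cancel_of_le inf_le_right]

theorem dvd_phiProd_inf {c : MvPolynomial (Fin r) ℤ} {n n' : (Fin r → ℕ) →₀ ℕ}
    (h : c ∣ phiProd n) (h' : c ∣ phiProd n') : c ∣ phiProd (n ⊓ n') := by
  rw [phiProd_eq_inf_mul_left n n'] at h
  rw [phiProd_eq_inf_mul_right n n'] at h'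
  exact dvd_of_dvd_mul_of_isRelPrime (isRelPrime_phiProd_sub_inf n n') h h'

/-- The indicator function of the vectors dividing `d`, i.e. the exponents of the factorization
`1 - t^d = ∏_{e ∣ d} φ_e(t)`. -/
noncomputable def divisorIndicator (d : Fin r → ℕ) : (Fin r → ℕ) →₀ ℕ :=
  ∑ k ∈ (Finset.univ.gcd d).divisors, Finsupp.single (k • primitivePart d) 1

theorem phiProd_divisorIndicator {d : Fin r → ℕ} (hd : d ≠ 0) :
    phiProd (divisorIndicator d) = 1 - tpow d := by
  simp only [divisorIndicator, phiProd_sum, phiProd_single, prod_phiVec hd]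

theorem divisorIndicator_le_one {d : Fin r → ℕ} (hd : d ≠ 0) (e : Fin r → ℕ) :
    divisorIndicator d e ≤ 1 := by
  classical
  simp only [divisorIndicator, Finsupp.coe_finsetSum, Finset.sum_apply, Finsupp.single_apply]
  rw [Finset.sum_boole, Nat.cast_id, Finset.card_le_one]
  intro k hk l hl
  have h : k • primitivePart d = l • primitivePart d :=
    (Finset.mem_filter.mp hk).2.trans (Finset.mem_filter.mp hl).2.symm
  obtain ⟨i, hi⟩ := Function.ne_iff.mp (primitivePart_ne_zero hd)
  exact Nat.eq_of_mul_eq_mul_right (Nat.pos_of_ne_zero hi) (congrFun h i)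

theorem divisorIndicator_eq_zero {d e : Fin r → ℕ} (h : ¬ VecDvd e d) :
    divisorIndicator d e = 0 := by
  classical
  simp only [divisorIndicator, Finsupp.coe_finsetSum, Finset.sum_apply, Finsupp.single_apply]
  refine Finset.sum_eq_zero fun k hk => if_neg ?_
  rintro rfl
  refine h ⟨Finset.univ.gcd d / k, ?_⟩
  rw [smul_smul, Nat.div_mul_cancel (Nat.dvd_of_mem_divisors hk), gcd_nsmul_primitivePart]

theorem finite_setOf_vecDvd {d : Fin r → ℕ} (hd : d ≠ 0) : {e | VecDvd e d}.Finite := by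
  refine (Set.finite_Iic d).subset ?_
  rintro e ⟨k, rfl⟩
  have hk : 0 < k := Nat.pos_of_ne_zero fun h => hd (by simp [h])
  exact fun i => Nat.le_mul_of_pos_left _ hk

end PhiProd

section PolynomialSeries

variable {σ A : Type*} [CommRing A]

/-- The polynomials as a subring of the ring of power series. -/
noncomputable def polynomialSubring (σ A : Type*) [CommRing A] : Subring (MvPowerSeries σ A) :=
  (MvPolynomial.coeToMvPowerSeries.ringHom (σ := σ) (R := A)).range

theorem coe_mem_polynomialSubring (p : MvPolynomial σ A) :
    (p : MvPowerSeries σ A) ∈ polynomialSubring σ A := ⟨p, rfl⟩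

theorem mem_polynomialSubring_iff {F : MvPowerSeries σ A} :
    F ∈ polynomialSubring σ A ↔ {a | MvPowerSeries.coeff a F ≠ 0}.Finite := by
  classical
  constructor
  · rintro ⟨p, rfl⟩
    refine p.support.finite_toSet.subset fun a ha => ?_
    simpa using ha
  · refine fun h => ⟨∑ a ∈ h.toFinset, MvPolynomial.monomial a (MvPowerSeries.coeff a F), ?_⟩
    ext b
    rw [MvPolynomial.coeToMvPowerSeries.ringHom_apply, MvPolynomial.coeff_coe,
      MvPolynomial.coeff_sum]
    simp only [MvPolynomial.coeff_monomial, Finset.sum_ite_eq', Set.Finite.mem_toFinset,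
      Set.mem_ofPred_eq]
    exact ite_eq_left_iff.mpr fun hb => (not_not.mp hb).symm

theorem coe_mul_mem_polynomialSubring_of_isRelPrime [IsDomain A] [UniqueFactorizationMonoid A]
    {F : MvPowerSeries σ A} {g a b : MvPolynomial σ A} (ha0 : a ≠ 0) (hab : IsRelPrime a b)
    (ha : ((g * a : MvPolynomial σ A) : MvPowerSeries σ A) * F ∈ polynomialSubring σ A)
    (hb : ((g * b : MvPolynomial σ A) : MvPowerSeries σ A) * F ∈ polynomialSubring σ A) :
    (g : MvPowerSeries σ A) * F ∈ polynomialSubring σ A := by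
  obtain ⟨p, hp⟩ := ha
  obtain ⟨q, hq⟩ := hb
  rw [MvPolynomial.coeToMvPowerSeries.ringHom_apply, MvPolynomial.coe_mul] at hp hq
  have h : b * p = a * q := by
    rw [← MvPolynomial.coe_inj, MvPolynomial.coe_mul, MvPolynomial.coe_mul, hp, hq]
    ring
  obtain ⟨s, rfl⟩ : a ∣ p := hab.dvd_of_dvd_mul_left ⟨q, h⟩
  have ha' : (a : MvPowerSeries σ A) ≠ 0 := by simpa using ha0
  refine ⟨s, mul_left_cancel₀ ha' ?_⟩
  rw [MvPolynomial.coeToMvPowerSeries.ringHom_apply, ← MvPolynomial.coe_mul, hp]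
  ring

end PolynomialSeries

section LaurentSeries

variable {r : ℕ}

/-- The power series `t^{-c} H`, where the terms of `H` with an exponent not above `c` are
discarded. It is used for `H` without such terms. -/
def shiftSeries (c : Fin r → ℤ) (H : FormalLaurent r) : MvPowerSeries (Fin r) ℤ :=
  fun a => H (fun i => (a i : ℤ) + c i)

theorem coeff_shiftSeries (c : Fin r → ℤ) (H : FormalLaurent r) (a : Fin r →₀ ℕ) :
    MvPowerSeries.coeff a (shiftSeries c H) = H (fun i => (a i : ℤ) + c i) := rfl

theorem polyMul_eq_sum {B : MvPolynomial (Fin r) ℤ} {s : Finset (Fin r →₀ ℕ)} (hs : B.support ⊆ s)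
    (H : FormalLaurent r) (e : Fin r → ℤ) :
    polyMul B H e = ∑ a ∈ s, B.coeff a * H (fun i => e i - (a i : ℤ)) :=
  Finset.sum_subset hs fun a _ ha => by simp [MvPolynomial.notMem_support_iff.mp ha]

theorem polyMul_add (B B' : MvPolynomial (Fin r) ℤ) (H : FormalLaurent r) :
    polyMul (B + B') H = polyMul B H + polyMul B' H := by
  classical
  ext e
  rw [Pi.add_apply, polyMul_eq_sum MvPolynomial.support_add, polyMul_eq_sum (B := B)
    Finset.subset_union_left, polyMul_eq_sum (B := B') Finset.subset_union_right,
    ← Finset.sum_add_distrib]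
  simp [add_mul]

theorem polyMul_monomial (b : Fin r →₀ ℕ) (m : ℤ) (H : FormalLaurent r) (e : Fin r → ℤ) :
    polyMul (MvPolynomial.monomial b m) H e = m * H (fun i => e i - (b i : ℤ)) := by
  classical
  rw [polyMul_eq_sum MvPolynomial.support_monomial_subset]
  simp

theorem shiftSeries_polyMul {c : Fin r → ℤ} {H : FormalLaurent r} (hH : ∀ e, H e ≠ 0 → c ≤ e)
    (B : MvPolynomial (Fin r) ℤ) :
    shiftSeries c (polyMul B H) = (B : MvPowerSeries (Fin r) ℤ) * shiftSeries c H := by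
  classical
  induction B using MvPolynomial.induction_on' with
  | monomial b m =>
    ext a
    rw [coeff_shiftSeries, polyMul_monomial, MvPolynomial.coe_monomial,
      MvPowerSeries.coeff_monomial_mul]
    split_ifs with h
    · rw [coeff_shiftSeries]
      congr 2
      ext i
      rw [Finsupp.coe_tsub, Pi.sub_apply, Nat.cast_sub (h i)]
      ring
    · by_contra h0
      refine h fun i => ?_
      have : c i ≤ a i + c i - b i := hH _ (right_ne_zero_of_mul h0) i
      omega
  | add B B' hB hB' =>
    rw [polyMul_add, MvPolynomial.coe_add, add_mul, ← hB, ← hB']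
    rfl

theorem le_of_polyMul_ne_zero {c : Fin r → ℤ} {H : FormalLaurent r} (hH : ∀ e, H e ≠ 0 → c ≤ e)
    (B : MvPolynomial (Fin r) ℤ) (e : Fin r → ℤ) (he : polyMul B H e ≠ 0) : c ≤ e := by
  obtain ⟨a, -, ha⟩ := Finset.exists_ne_zero_of_sum_ne_zero he
  refine (hH _ (right_ne_zero_of_mul ha)).trans fun i => ?_
  exact sub_le_self (e i) (Int.natCast_nonneg (a i))

theorem isLaurentPolynomial_iff {c : Fin r → ℤ} {H : FormalLaurent r}
    (hH : ∀ e, H e ≠ 0 → c ≤ e) :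
    IsLaurentPolynomial H ↔ shiftSeries c H ∈ polynomialSubring (Fin r) ℤ := by
  let shift (a : Fin r →₀ ℕ) (i : Fin r) : ℤ := (a i : ℤ) + c i
  have hinj : Function.Injective shift := fun a b hab =>
    Finsupp.ext fun i => by simpa [shift] using congrFun hab i
  have hrange : Function.support H ⊆ Set.range shift := fun e he => by
    refine ⟨Finsupp.equivFunOnFinite.symm fun i => (e i - c i).toNat, funext fun i => ?_⟩
    have : c i ≤ e i := hH e he i
    simp [shift, this]
  rw [mem_polynomialSubring_iff, IsLaurentPolynomial]
  exact ⟨fun h => h.preimage hinj.injOn, fun h => Set.finite_of_finite_preimage h hrange⟩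

theorem isLaurentPolynomial_polyMul_iff {c : Fin r → ℤ} {H : FormalLaurent r}
    (hH : ∀ e, H e ≠ 0 → c ≤ e) (B : MvPolynomial (Fin r) ℤ) :
    IsLaurentPolynomial (polyMul B H) ↔
      (B : MvPowerSeries (Fin r) ℤ) * shiftSeries c H ∈ polynomialSubring (Fin r) ℤ := by
  rw [isLaurentPolynomial_iff (le_of_polyMul_ne_zero hH B), shiftSeries_polyMul hH]

end LaurentSeries

section Decomposition

variable {ι K M : Type*} [DecidableEq ι] [CommRing K] [AddCommGroup M] [Module K M]

/-- The projection of a graded module onto its component of degree `d`. -/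
noncomputable def proj (ℳ : ι → Submodule K M) [DirectSum.Decomposition ℳ] (d : ι) : M →ₗ[K] M :=
  (ℳ d).subtype ∘ₗ DirectSum.component K _ _ d ∘ₗ (DirectSum.decomposeLinearEquiv ℳ).toLinearMap

variable (ℳ : ι → Submodule K M) [DirectSum.Decomposition ℳ]

theorem proj_apply (d : ι) (x : M) : proj ℳ d x = (DirectSum.decompose ℳ x d : M) := rfl

theorem proj_mem (d : ι) (x : M) : proj ℳ d x ∈ ℳ d := (DirectSum.decompose ℳ x d).2

theorem proj_of_mem {d : ι} {x : M} (hx : x ∈ ℳ d) : proj ℳ d x = x :=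
  DirectSum.decompose_of_mem_same ℳ hx

theorem proj_of_mem_of_ne {d e : ι} {x : M} (hx : x ∈ ℳ d) (h : d ≠ e) : proj ℳ e x = 0 :=
  DirectSum.decompose_of_mem_ne ℳ hx h

theorem finite_setOf_proj_ne_zero (x : M) : {d | proj ℳ d x ≠ 0}.Finite := by
  classical
  refine (DFinsupp.support (DirectSum.decompose ℳ x)).finite_toSet.subset fun d hd => ?_
  simpa [proj_apply] using hd

theorem finite_range_proj (x : M) : (Set.range fun d => proj ℳ d x).Finite := by
  refine (((finite_setOf_proj_ne_zero ℳ x).image fun d => proj ℳ d x).insert 0).subset ?_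
  rintro _ ⟨d, rfl⟩
  exact or_iff_not_imp_left.mpr fun hd => ⟨d, hd, rfl⟩

theorem mem_of_forall_proj_mem {S : Type*} [SetLike S M] [AddSubmonoidClass S M] {N : S} {x : M}
    (h : ∀ d, proj ℳ d x ∈ N) : x ∈ N := by
  classical
  rw [← DirectSum.sum_support_decompose ℳ x]
  exact sum_mem fun d _ => h d

theorem proj_mem_span {S : Set M} (hS : ∀ x ∈ S, ∃ d, x ∈ ℳ d) (d : ι) {x : M}
    (hx : x ∈ Submodule.span K S) : proj ℳ d x ∈ Submodule.span K S := by
  refine Submodule.span_le (p := (Submodule.span K S).comap (proj ℳ d)).mpr (fun y hy => ?_) hx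
  obtain ⟨e, he⟩ := hS y hy
  rw [SetLike.mem_coe, Submodule.mem_comap]
  obtain rfl | hed := eq_or_ne e d
  · rw [proj_of_mem ℳ he]
    exact Submodule.subset_span hy
  · rw [proj_of_mem_of_ne ℳ he hed]
    exact zero_mem _

theorem exists_finite_homogeneous_subset_span {R : Type*} [Semiring R] [Module R M] {S : Set M}
    (hS : S.Finite) : ∃ T : Set M, T.Finite ∧ (∀ x ∈ T, ∃ d, x ∈ ℳ d) ∧
      S ⊆ Submodule.span R T := by
  refine ⟨⋃ x ∈ S, Set.range fun d => proj ℳ d x,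
    hS.biUnion fun x _ => finite_range_proj ℳ x, fun x hx => ?_, fun x hx => ?_⟩
  · obtain ⟨y, -, d, rfl⟩ := Set.mem_iUnion₂.mp hx
    exact ⟨d, proj_mem ℳ d y⟩
  · exact mem_of_forall_proj_mem ℳ fun d =>
      Submodule.subset_span (Set.mem_biUnion hx (Set.mem_range_self d))

theorem exists_finite_homogeneous_generators (R : Type*) [Semiring R] [Module R M]
    [Module.Finite R M] :
    ∃ T : Set M, T.Finite ∧ (∀ x ∈ T, ∃ d, x ∈ ℳ d) ∧ Submodule.span R T = ⊤ := by
  obtain ⟨S, hS⟩ := Module.Finite.fg_top (R := R) (M := M)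
  obtain ⟨T, hT, hhom, hST⟩ :=
    exists_finite_homogeneous_subset_span ℳ (R := R) S.finite_toSet
  exact ⟨T, hT, hhom, top_le_iff.mp (hS ▸ Submodule.span_le.mpr hST)⟩

theorem isHomogeneous_sup {R : Type*} [Semiring R] [Module R M] {N N' : Submodule R M}
    (hN : N.IsHomogeneous ℳ) (hN' : N'.IsHomogeneous ℳ) : (N ⊔ N').IsHomogeneous ℳ := by
  intro e x hx
  obtain ⟨y, hy, z, hz, rfl⟩ := Submodule.mem_sup.mp hx
  rw [← proj_apply, map_add]
  exact Submodule.add_mem_sup (hN e hy) (hN' e hz)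

end Decomposition

section Graded

/-- Degrees of ring elements act on degrees of module elements by translation, so that a graded
module is a graded structure in the sense of `SetLike.GradedSMul`. -/
instance natVecAddAction {σ : Type*} : AddAction (σ → ℕ) (σ → ℤ) where
  vadd e d := fun i => (e i : ℤ) + d i
  zero_vadd d := funext fun i => by
    change ((0 : ℕ) : ℤ) + d i = d i
    rw [Nat.cast_zero, zero_add]
  add_vadd e e' d := funext fun i => by
    change ((e i + e' i : ℕ) : ℤ) + d i = e i + (e' i + d i)
    rw [Nat.cast_add, add_assoc]

theorem natVec_vadd_apply {σ : Type*} (e : σ → ℕ) (d : σ → ℤ) (i : σ) :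
    (e +ᵥ d) i = (e i : ℤ) + d i := rfl

theorem natVec_vadd_eq_iff {σ : Type*} {e : σ → ℕ} {d d' : σ → ℤ} :
    e +ᵥ d = d' ↔ d = fun i => d' i - e i := by
  simp only [funext_iff, natVec_vadd_apply, eq_sub_iff_add_eq']

theorem natVec_vadd_right_cancel {σ : Type*} {e e' : σ → ℕ} {d : σ → ℤ} (h : e +ᵥ d = e' +ᵥ d) :
    e = e' :=
  funext fun i => by simpa only [natVec_vadd_apply, add_left_inj, Nat.cast_inj] using congrFun h i

theorem exists_natVec_vadd_eq {σ : Type*} {c d : σ → ℤ} (h : c ≤ d) : ∃ e : σ → ℕ, e +ᵥ c = d :=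
  ⟨fun i => (d i - c i).toNat, funext fun i => by
    rw [natVec_vadd_apply, Int.toNat_of_nonneg (sub_nonneg.mpr (h i)), sub_add_cancel]⟩

variable {σ K R M : Type*} [CommRing K] [CommRing R] [Algebra K R] [AddCommGroup M]
  [Module K M] [Module R M] [DecidableEq (σ → ℤ)]
  {𝒜 : (σ → ℕ) → Submodule K R} {ℳ : (σ → ℤ) → Submodule K M} [DirectSum.Decomposition ℳ]

section Action

variable [SetLike.GradedSMul 𝒜 ℳ]

theorem proj_smul {δ : σ → ℕ} {a : R} (ha : a ∈ 𝒜 δ) (e : σ → ℤ) (x : M) :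
    proj ℳ e (a • x) = a • proj ℳ (fun i => e i - δ i) x := by
  induction x using DirectSum.Decomposition.inductionOn ℳ with
  | zero => simp
  | @homogeneous d x =>
    have hx : a • (x : M) ∈ ℳ (δ +ᵥ d) := SetLike.GradedSMul.smul_mem ha x.2
    by_cases h : δ +ᵥ d = e
    · rw [proj_of_mem ℳ (h ▸ hx), ← natVec_vadd_eq_iff.mp h, proj_of_mem ℳ x.2]
    · rw [proj_of_mem_of_ne ℳ hx h,
        proj_of_mem_of_ne ℳ x.2 fun hd => h (natVec_vadd_eq_iff.mpr hd), smul_zero]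
  | add x y hx hy => rw [smul_add, map_add, hx, hy, map_add, smul_add]

theorem isHomogeneous_map_smul {N : Submodule R M} (hN : N.IsHomogeneous ℳ) {δ : σ → ℕ} {f : R}
    (hf : f ∈ 𝒜 δ) : (N.map (f • LinearMap.id)).IsHomogeneous ℳ := by
  rintro e _ ⟨x, hx, rfl⟩
  rw [← proj_apply]
  exact ⟨_, hN (fun i => e i - δ i) hx, (proj_smul hf e x).symm⟩

theorem isHomogeneous_inf_comap_smul {N N' : Submodule R M} (hN : N.IsHomogeneous ℳ)
    (hN' : N'.IsHomogeneous ℳ) {δ : σ → ℕ} {f : R} (hf : f ∈ 𝒜 δ) :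
    (N ⊓ N'.comap (f • LinearMap.id)).IsHomogeneous ℳ := by
  rintro e x ⟨hx, hfx⟩
  refine ⟨hN e hx, ?_⟩
  have := hN' (fun i => e i + δ i) hfx
  rw [← proj_apply, LinearMap.smul_apply, LinearMap.id_apply, proj_smul hf] at this
  simp only [add_sub_cancel_right] at this
  exact this

variable [DecidableEq (σ → ℕ)] [GradedAlgebra 𝒜]

variable (𝒜) in
include 𝒜 in
theorem proj_smul_mem {N : Submodule R M} {x : M} {d : σ → ℤ}
    (hx : ∀ δ : σ → ℕ, proj ℳ (fun i => d i - δ i) x ∈ N) (a : R) : proj ℳ d (a • x) ∈ N := by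
  induction a using DirectSum.Decomposition.inductionOn 𝒜 with
  | zero => simp
  | @homogeneous δ a =>
    rw [proj_smul (𝒜 := 𝒜) a.2]
    exact N.smul_mem _ (hx δ)
  | add a b ha hb => rw [add_smul, map_add]; exact N.add_mem ha hb

variable (𝒜 ℳ) in
/-- The submodule of the elements all of whose components have degree at least `c`. -/
def truncation (c : σ → ℤ) : Submodule R M where
  carrier := {x | ∀ d, ¬ c ≤ d → proj ℳ d x = 0}
  zero_mem' _ _ := map_zero _
  add_mem' hx hy d hd := by rw [map_add, hx d hd, hy d hd, add_zero]
  smul_mem' a x hx d hd := proj_smul_mem 𝒜 (N := ⊥) (fun δ => hx _ fun hc =>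
    hd (hc.trans fun i => sub_le_self _ (Int.natCast_nonneg _))) a

variable (R 𝒜 ℳ) in
include 𝒜 in
theorem exists_forall_le_of_ne_bot [Module.Finite R M] :
    ∃ c : σ → ℤ, ∀ d, ℳ d ≠ ⊥ → c ≤ d := by
  obtain ⟨T, hT, hhom, hspan⟩ := exists_finite_homogeneous_generators ℳ R
  choose! deg hdeg using hhom
  obtain ⟨c, hc⟩ := (hT.image deg).bddBelow
  have htop : Submodule.span R T ≤ truncation 𝒜 ℳ c := Submodule.span_le.mpr fun x hx d hd =>
    proj_of_mem_of_ne ℳ (hdeg x hx) fun h => hd (h ▸ hc ⟨x, hx, rfl⟩)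
  refine ⟨c, fun d hne => by_contra fun hd => hne ((Submodule.eq_bot_iff _).mpr fun x hx => ?_)⟩
  rw [← proj_of_mem ℳ hx]
  exact htop (hspan ▸ Submodule.mem_top) d hd

variable [IsScalarTower K R M]

variable (𝒜) in
include 𝒜 in
theorem isHomogeneous_span {S : Set M} (hS : ∀ x ∈ S, ∃ d, x ∈ ℳ d) :
    (Submodule.span R S).IsHomogeneous ℳ := by
  intro e x hx
  rw [← proj_apply]
  induction hx using Submodule.span_induction generalizing e with
  | mem x hx =>
    exact Submodule.span_subset_span K R S (proj_mem_span ℳ hS e (Submodule.subset_span hx))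
  | zero => simp
  | add x y _ _ hx hy => rw [map_add]; exact add_mem (hx e) (hy e)
  | smul a x _ hx => exact proj_smul_mem 𝒜 (fun _ => hx _) a

end Action

end Graded

section Nakayama

theorem degree_induction {σ : Type*} [Finite σ] {P : (σ → ℤ) → Prop} (c : σ → ℤ)
    (h0 : ∀ d, ¬ c ≤ d → P d)
    (step : ∀ d, (∀ δ : σ → ℕ, δ ≠ 0 → P (fun i => d i - δ i)) → P d) (d : σ → ℤ) : P d := by
  have := Fintype.ofFinite σ
  suffices h : ∀ (n : ℕ) (d : σ → ℤ), ∑ i, d i < ∑ i, c i + n → P d from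
    h (∑ i, d i - ∑ i, c i + 1).toNat d (by omega)
  intro n
  induction n with
  | zero =>
    refine fun d hd => h0 d fun hcd => ?_
    have : ∑ i, c i ≤ ∑ i, d i := Finset.sum_le_sum fun i _ => hcd i
    omega
  | succ n ih =>
    refine fun d hd => step d fun δ hδ => ih _ ?_
    have : 0 < ∑ i, (δ i : ℤ) := by
      obtain ⟨i, hi⟩ := Function.ne_iff.mp hδ
      exact Finset.sum_pos' (fun _ _ => Int.natCast_nonneg _)
        ⟨i, Finset.mem_univ i, Int.natCast_pos.mpr (Nat.pos_of_ne_zero hi)⟩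
    rw [Finset.sum_sub_distrib]
    omega

theorem finite_of_annihilator_le {K R M : Type*} [CommRing K] [CommRing R] [Algebra K R]
    [AddCommGroup M] [Module K M] [Module R M] [IsScalarTower K R M] [Module.Finite R M]
    {I : Ideal R} (hI : I ≤ Module.annihilator R M) [Module.Finite K (R ⧸ I)] :
    Module.Finite K M := by
  have htors : Module.IsTorsionBySet R M I := fun x a =>
    Module.mem_annihilator.mp (hI a.2) x
  let := htors.module
  have : IsScalarTower R (R ⧸ I) M := htors.isScalarTower
  have : IsScalarTower K (R ⧸ I) M := htors.isScalarTower
  have := Module.Finite.of_restrictScalars_finite R (R ⧸ I) M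
  exact Module.Finite.trans (R ⧸ I) M

variable {ι : Type*} [Fintype ι]

/-- The map `(zᵢ) ↦ ∑ᵢ hᵢ zᵢ`, with range `∑ᵢ hᵢ M`. -/
def sumSMul {R : Type*} (M : Type*) [CommRing R] [AddCommGroup M] [Module R M] (h : ι → R) :
    (ι → M) →ₗ[R] M :=
  ∑ i, h i • LinearMap.proj i

theorem sumSMul_apply {R M : Type*} [CommRing R] [AddCommGroup M] [Module R M] (h : ι → R)
    (z : ι → M) : sumSMul M h z = ∑ i, h i • z i := by
  simp [sumSMul]

theorem smul_mem_range_sumSMul {R M : Type*} [CommRing R] [AddCommGroup M] [Module R M]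
    (h : ι → R) (i : ι) (x : M) : h i • x ∈ LinearMap.range (sumSMul M h) := by
  classical
  refine ⟨Pi.single i x, ?_⟩
  rw [sumSMul_apply, Finset.sum_eq_single i (by simp +contextual) (by simp), Pi.single_eq_same]

variable {K R M : Type*} [Field K] [CommRing R] [Algebra K R] [AddCommGroup M] [Module K M]
  [Module R M] [IsScalarTower K R M]

theorem finite_quotient_range_sumSMul [Module.Finite R M] (h : ι → R)
    [Module.Finite K (R ⧸ (Module.annihilator R M ⊔ Ideal.span (Set.range h)))] :
    Module.Finite K (M ⧸ LinearMap.range (sumSMul M h)) := by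
  refine finite_of_annihilator_le (R := R)
    (I := Module.annihilator R M ⊔ Ideal.span (Set.range h)) (sup_le ?_ (Ideal.span_le.mpr ?_))
  · exact LinearMap.annihilator_le_of_surjective _ (Submodule.mkQ_surjective _)
  · rintro _ ⟨i, rfl⟩
    refine Module.mem_annihilator.mpr fun y => ?_
    obtain ⟨x, rfl⟩ := Submodule.mkQ_surjective _ y
    exact (Submodule.Quotient.mk_eq_zero _).mpr (smul_mem_range_sumSMul h i x)

theorem exists_finite_span_sup_eq_top (N : Submodule R M) [Module.Finite K (M ⧸ N)] :
    ∃ S : Set M, S.Finite ∧ Submodule.span K S ⊔ N.restrictScalars K = ⊤ := by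
  obtain ⟨Q, hQ⟩ := Module.Finite.fg_top (R := K) (M := M ⧸ N)
  choose lift hlift using N.mkQ_surjective
  refine ⟨lift '' Q, Q.finite_toSet.image lift, ?_⟩
  have hker : LinearMap.ker (N.mkQ.restrictScalars K) = N.restrictScalars K := by
    rw [LinearMap.ker_restrictScalars, Submodule.ker_mkQ]
  have himage : N.mkQ.restrictScalars K '' (lift '' Q) = Q := by
    simp only [Set.image_image, LinearMap.coe_restrictScalars, hlift, Set.image_id']
  rw [← hker, ← Submodule.comap_map_eq, Submodule.map_span, himage, hQ, Submodule.comap_top]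

variable {σ : Type*} [DecidableEq (σ → ℤ)] {𝒜 : (σ → ℕ) → Submodule K R}
  {ℳ : (σ → ℤ) → Submodule K M} [DirectSum.Decomposition ℳ] [SetLike.GradedSMul 𝒜 ℳ]

variable (ℳ) in
theorem exists_finite_homogeneous_add_sum_smul {h : ι → R} {δ : ι → σ → ℕ}
    (hh : ∀ i, h i ∈ 𝒜 (δ i)) [Module.Finite R M]
    [Module.Finite K (R ⧸ (Module.annihilator R M ⊔ Ideal.span (Set.range h)))] :
    ∃ T : Set M, T.Finite ∧ ∀ d, ∀ x ∈ ℳ d, ∃ w ∈ Submodule.span K T, ∃ z : ι → M,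
      (∀ i, z i ∈ ℳ (fun j => d j - δ i j)) ∧ x = w + ∑ i, h i • z i := by
  have := finite_quotient_range_sumSMul (K := K) (M := M) h
  obtain ⟨S, hS, htop⟩ :=
    exists_finite_span_sup_eq_top (K := K) (LinearMap.range (sumSMul M h))
  obtain ⟨T, hT, hhom, hST⟩ := exists_finite_homogeneous_subset_span ℳ (R := K) hS
  refine ⟨T, hT, fun d x hx => ?_⟩
  obtain ⟨w, hw, _, ⟨z, rfl⟩, rfl⟩ := Submodule.mem_sup.mp (htop ▸ Submodule.mem_top (x := x))
  refine ⟨proj ℳ d w, proj_mem_span ℳ hhom d (Submodule.span_le.mpr hST hw),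
    fun i => proj ℳ (fun j => d j - δ i j) (z i), fun i => proj_mem ℳ _ _, ?_⟩
  rw [← proj_of_mem ℳ hx, map_add, sumSMul_apply, map_sum]
  simp only [proj_smul (hh _)]

variable [Finite σ] [DecidableEq (σ → ℕ)] [GradedAlgebra 𝒜]

variable (ℳ)

include 𝒜 in
theorem finite_component {ι : Type*} [Finite ι] {h : ι → R} {δ : ι → σ → ℕ}
    (hh : ∀ i, h i ∈ 𝒜 (δ i)) (hδ : ∀ i, δ i ≠ 0) [Module.Finite R M]
    [Module.Finite K (R ⧸ (Module.annihilator R M ⊔ Ideal.span (Set.range h)))] (d : σ → ℤ) :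
    FiniteDimensional K (ℳ d) := by
  have := Fintype.ofFinite ι
  obtain ⟨T, hT, hTh⟩ := exists_finite_homogeneous_add_sum_smul ℳ hh
  obtain ⟨c, hc⟩ := exists_forall_le_of_ne_bot R 𝒜 ℳ
  induction d using degree_induction c with
  | h0 d hd =>
    rw [not_imp_comm.mp (hc d) hd]
    infer_instance
  | step d ih =>
    have hfin : ∀ i, FiniteDimensional K (ℳ fun j => d j - δ i j) := fun i => ih (δ i) (hδ i)
    have := FiniteDimensional.span_of_finite K hT
    have hle : ℳ d ≤ Submodule.span K T ⊔
        ⨆ i, (ℳ fun j => d j - δ i j).map ((h i • LinearMap.id : M →ₗ[R] M).restrictScalars K) := by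
      intro x hx
      obtain ⟨w, hw, z, hz, rfl⟩ := hTh d x hx
      refine Submodule.add_mem_sup hw (Submodule.sum_mem _ fun i _ => ?_)
      exact Submodule.mem_iSup_of_mem i ⟨z i, hz i, rfl⟩
    exact Submodule.finiteDimensional_of_le hle

include 𝒜 ℳ in
theorem finite_adjoin {ι : Type*} [Finite ι] {h : ι → R} {δ : ι → σ → ℕ} (hh : ∀ i, h i ∈ 𝒜 (δ i))
    (hδ : ∀ i, δ i ≠ 0) [Module.Finite R M]
    [Module.Finite K (R ⧸ (Module.annihilator R M ⊔ Ideal.span (Set.range h)))] :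
    Module.Finite (Algebra.adjoin K (Set.range h)) M := by
  have := Fintype.ofFinite ι
  obtain ⟨T, hT, hTh⟩ := exists_finite_homogeneous_add_sum_smul ℳ hh
  obtain ⟨c, hc⟩ := exists_forall_le_of_ne_bot R 𝒜 ℳ
  have hle : ∀ d, ∀ x ∈ ℳ d, x ∈ Submodule.span (Algebra.adjoin K (Set.range h)) T := by
    intro d
    induction d using degree_induction c with
    | h0 d hd =>
      intro x hx
      rw [not_imp_comm.mp (hc d) hd, Submodule.mem_bot] at hx
      exact hx ▸ zero_mem _
    | step d ih =>
      intro x hx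
      obtain ⟨w, hw, z, hz, rfl⟩ := hTh d x hx
      refine add_mem (Submodule.span_subset_span K _ _ hw) (Submodule.sum_mem _ fun i _ => ?_)
      exact Submodule.smul_mem _
        (⟨h i, Algebra.subset_adjoin ⟨i, rfl⟩⟩ : Algebra.adjoin K (Set.range h))
        (ih (δ i) (hδ i) _ (hz i))
  refine Module.finite_def.mpr (Submodule.fg_def.mpr ⟨T, hT, top_le_iff.mp fun x _ => ?_⟩)
  exact mem_of_forall_proj_mem ℳ fun d => hle d _ (proj_mem ℳ d x)

end Nakayama

section HilbertSerre

variable {K R M : Type*} [Field K] [CommRing R] [Algebra K R] [AddCommGroup M] [Module K M]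
  [Module R M] [IsScalarTower K R M] {r : ℕ}

theorem finrank_map_add_finrank_ker_inf {V W : Type*} [AddCommGroup V] [Module K V]
    [AddCommGroup W] [Module K W] (g : V →ₗ[K] W) (U : Submodule K V) [FiniteDimensional K U] :
    Module.finrank K (U.map g) + Module.finrank K ↥(LinearMap.ker g ⊓ U) = Module.finrank K U := by
  rw [← LinearMap.finrank_range_add_finrank_ker (g.domRestrict U), LinearMap.range_domRestrict,
    LinearMap.ker_domRestrict,
    LinearEquiv.finrank_eq (Submodule.equivSubtypeMap U ((LinearMap.ker g).comap U.subtype)),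
    Submodule.map_comap_subtype, inf_comm]

section HilbertFunction

variable {𝒜 : (Fin r → ℕ) → Submodule K R} {ℳ : (Fin r → ℤ) → Submodule K M}

theorem hilbertSeries_eq_add [∀ d, FiniteDimensional K (ℳ d)] {N N' : Submodule R M} (h : N' ≤ N)
    (d : Fin r → ℤ) : hilbertSeries ℳ N d = hilbertSeries ℳ N' d +
      Module.finrank K ((N.restrictScalars K ⊓ ℳ d).map (N'.mkQ.restrictScalars K)) := by
  have : FiniteDimensional K ↥(N.restrictScalars K ⊓ ℳ d) :=
    Submodule.finiteDimensional_of_le inf_le_right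
  have hker : LinearMap.ker (N'.mkQ.restrictScalars K) ⊓ (N.restrictScalars K ⊓ ℳ d) =
      N'.restrictScalars K ⊓ ℳ d := by
    rw [LinearMap.ker_restrictScalars, Submodule.ker_mkQ, ← inf_assoc,
      inf_eq_left.mpr (show N'.restrictScalars K ≤ N.restrictScalars K from h)]
  rw [hilbertSeries, hilbertSeries, ← hker, add_comm, ← Nat.cast_add,
    finrank_map_add_finrank_ker_inf]

theorem le_of_hilbertSeries_ne_zero {c : Fin r → ℤ} (hc : ∀ d, ℳ d ≠ ⊥ → c ≤ d)
    (N : Submodule R M) (d : Fin r → ℤ) (hd : hilbertSeries ℳ N d ≠ 0) : c ≤ d := by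
  refine hc d fun h => hd ?_
  rw [hilbertSeries, h, inf_bot_eq, finrank_bot, Nat.cast_zero]

variable [DirectSum.Decomposition ℳ]

theorem map_mkQ_smul_inf_component [SetLike.GradedSMul 𝒜 ℳ] {N N' : Submodule R M}
    (hN : N.IsHomogeneous ℳ) (hN' : N'.IsHomogeneous ℳ) {δ : Fin r → ℕ} {f : R} (hf : f ∈ 𝒜 δ)
    (e : Fin r → ℤ) :
    (N.restrictScalars K ⊓ ℳ fun i => e i - δ i).map
        ((N'.mkQ ∘ₗ (f • LinearMap.id)).restrictScalars K) =
      ((N.map (f • LinearMap.id) ⊔ N').restrictScalars K ⊓ ℳ e).map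
        (N'.mkQ.restrictScalars K) := by
  apply le_antisymm
  · rintro _ ⟨x, ⟨hx, hxd⟩, rfl⟩
    have hfx : f • x ∈ ℳ (δ +ᵥ fun i => e i - (δ i : ℤ)) := SetLike.GradedSMul.smul_mem hf hxd
    rw [natVec_vadd_eq_iff.mpr rfl] at hfx
    exact ⟨f • x, ⟨Submodule.mem_sup_left ⟨x, hx, rfl⟩, hfx⟩, rfl⟩
  · rintro _ ⟨_, ⟨hx, hxe⟩, rfl⟩
    obtain ⟨_, ⟨y, hy, rfl⟩, z, hz, rfl⟩ := Submodule.mem_sup.mp hx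
    refine ⟨proj ℳ (fun i => e i - δ i) y, ⟨hN _ hy, proj_mem ℳ _ y⟩, ?_⟩
    refine (Submodule.Quotient.eq N').mpr ?_
    rw [← proj_of_mem ℳ hxe, map_add, LinearMap.smul_apply, LinearMap.smul_apply,
      LinearMap.id_apply, LinearMap.id_apply, proj_smul hf, sub_add_cancel_left]
    exact N'.neg_mem (hN' e hz)

/-- In degree `e`, the sequence `0 → (0 :_{N/N'} f)(-δ) → (N/N')(-δ) → N/N' → N/(fN + N') → 0`
is exact; the dimension of the image of multiplication by `f` is computed at both ends. -/
theorem hilbertSeries_sub_inf_comap_smul [SetLike.GradedSMul 𝒜 ℳ]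
    [∀ d, FiniteDimensional K (ℳ d)] {N N' : Submodule R M} (hN : N.IsHomogeneous ℳ)
    (hN' : N'.IsHomogeneous ℳ) {δ : Fin r → ℕ} {f : R} (hf : f ∈ 𝒜 δ) (e : Fin r → ℤ) :
    hilbertSeries ℳ N (fun i => e i - δ i) -
      hilbertSeries ℳ (N ⊓ N'.comap (f • LinearMap.id)) (fun i => e i - δ i) =
    hilbertSeries ℳ (N.map (f • LinearMap.id) ⊔ N') e - hilbertSeries ℳ N' e := by
  set U := N.restrictScalars K ⊓ ℳ fun i => e i - δ i with hU
  have : FiniteDimensional K U := Submodule.finiteDimensional_of_le inf_le_right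
  set g : M →ₗ[K] M ⧸ N' := (N'.mkQ ∘ₗ (f • LinearMap.id)).restrictScalars K with hg
  have hker : LinearMap.ker g ⊓ U =
      (N ⊓ N'.comap (f • LinearMap.id)).restrictScalars K ⊓ ℳ fun i => e i - δ i := by
    rw [hg, LinearMap.ker_restrictScalars, LinearMap.ker_comp, Submodule.ker_mkQ, hU, ← inf_assoc,
      inf_comm (Submodule.restrictScalars K (Submodule.comap _ N'))]
    rfl
  rw [hilbertSeries_eq_add (le_sup_right : N' ≤ N.map (f • LinearMap.id) ⊔ N') e,
    add_sub_cancel_left, sub_eq_iff_eq_add, ← map_mkQ_smul_inf_component hN hN' hf, hilbertSeries,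
    hilbertSeries, ← hker, ← Nat.cast_add, finrank_map_add_finrank_ker_inf]

/-- The Hilbert series of `N`, divided by `t^c`. -/
noncomputable def hilbertPowerSeries (c : Fin r → ℤ) (ℳ : (Fin r → ℤ) → Submodule K M)
    (N : Submodule R M) : MvPowerSeries (Fin r) ℤ :=
  shiftSeries c (hilbertSeries ℳ N)

theorem tpow_mul_hilbertPowerSeries_sub [SetLike.GradedSMul 𝒜 ℳ]
    [∀ d, FiniteDimensional K (ℳ d)] {c : Fin r → ℤ} (hc : ∀ d, ℳ d ≠ ⊥ → c ≤ d)
    {N N' : Submodule R M} (hN : N.IsHomogeneous ℳ) (hN' : N'.IsHomogeneous ℳ)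
    {δ : Fin r → ℕ} {f : R} (hf : f ∈ 𝒜 δ) :
    (tpow δ : MvPowerSeries (Fin r) ℤ) * (hilbertPowerSeries c ℳ N -
      hilbertPowerSeries c ℳ (N ⊓ N'.comap (f • LinearMap.id))) =
    hilbertPowerSeries c ℳ (N.map (f • LinearMap.id) ⊔ N') - hilbertPowerSeries c ℳ N' := by
  change (tpow δ : MvPowerSeries (Fin r) ℤ) * shiftSeries c (_ - _) = shiftSeries c (_ - _)
  rw [← shiftSeries_polyMul]
  · congr 1
    ext e
    rw [tpow_eq_monomial, polyMul_monomial, one_mul]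
    exact hilbertSeries_sub_inf_comap_smul hN hN' hf e
  · intro e he
    by_contra hce
    have hzero : ∀ N₁ : Submodule R M, hilbertSeries ℳ N₁ e = 0 := fun N₁ =>
      by_contra fun h => hce (le_of_hilbertSeries_ne_zero hc N₁ e h)
    exact he (by rw [Pi.sub_apply, hzero, hzero, sub_zero])

theorem finite_setOf_hilbertSeries_ne {N N' : Submodule R M} (hN' : N'.IsHomogeneous ℳ)
    (hle : N' ≤ N) {T : Set M} (hT : T.Finite)
    (hNT : N.restrictScalars K ≤ Submodule.span K T ⊔ N'.restrictScalars K) :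
    {d | hilbertSeries ℳ N d ≠ hilbertSeries ℳ N' d}.Finite := by
  refine (hT.biUnion fun x _ => finite_setOf_proj_ne_zero ℳ x).subset fun d hd => ?_
  by_contra hdT
  have hspan : Submodule.span K T ≤ LinearMap.ker (proj ℳ d) :=
    Submodule.span_le.mpr fun x hx => by_contra fun h => hdT (Set.mem_biUnion hx h)
  have hN : N.restrictScalars K ⊓ ℳ d = N'.restrictScalars K ⊓ ℳ d := by
    refine le_antisymm (fun x hx => ⟨?_, hx.2⟩) (inf_le_inf_right _ hle)
    obtain ⟨w, hw, y, hy, rfl⟩ := Submodule.mem_sup.mp (hNT hx.1)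
    rw [← proj_of_mem ℳ hx.2, map_add, LinearMap.mem_ker.mp (hspan hw), zero_add]
    exact hN' d hy
  exact hd (by rw [hilbertSeries, hilbertSeries, hN])

end HilbertFunction

theorem finite_quotient_span_of_adjoin_eq_top {K A : Type*} [CommRing K] [CommRing A] [Algebra K A]
    {S : Set A} (hS : Algebra.adjoin K S = ⊤) : Module.Finite K (A ⧸ Ideal.span S) := by
  have hbot : (⊤ : Subalgebra K (A ⧸ Ideal.span S)) = ⊥ := by
    rw [← (AlgHom.range_eq_top _).mpr (Ideal.Quotient.mkₐ_surjective K (Ideal.span S)),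
      ← Algebra.map_top, ← hS, AlgHom.map_adjoin, eq_bot_iff, Algebra.adjoin_le_iff]
    rintro _ ⟨s, hs, rfl⟩
    rw [Ideal.Quotient.mkₐ_eq_mk, Ideal.Quotient.eq_zero_iff_mem.mpr (Ideal.subset_span hs)]
    exact zero_mem _
  exact Module.Finite.of_surjective (Algebra.linearMap K _)
    (Algebra.surjective_algebraMap_iff.mpr hbot)

variable {ι : Type*} [Finite ι]

omit [Module K M] [IsScalarTower K R M] in
theorem isNoetherian_adjoin (f : ι → R) [Module.Finite (Algebra.adjoin K (Set.range f)) M] :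
    IsNoetherian (Algebra.adjoin K (Set.range f)) M := by
  have : Algebra.FiniteType K (Algebra.adjoin K (Set.range f)) :=
    (Subalgebra.fg_iff_finiteType _).mp
      (Subalgebra.fg_def.mpr ⟨_, Set.finite_range f, rfl⟩)
  have : IsNoetherianRing (Algebra.adjoin K (Set.range f)) :=
    Algebra.FiniteType.isNoetherianRing K _
  exact isNoetherian_of_isNoetherianRing_of_finite _ M

theorem finite_quotient_submoduleOf {f : ι → R}
    [Module.Finite (Algebra.adjoin K (Set.range f)) M] {N N' : Submodule R M}
    (hN : ∀ i, ∀ x ∈ N, f i • x ∈ N') : Module.Finite K (N ⧸ N'.submoduleOf N) := by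
  set A := Algebra.adjoin K (Set.range f)
  have : IsNoetherian A M := isNoetherian_adjoin f
  have : Module.Finite A N :=
    Module.Finite.of_fg (IsNoetherian.noetherian (N.restrictScalars A))
  have : Module.Finite A (N ⧸ N'.submoduleOf N) :=
    Module.Finite.of_surjective ((N'.submoduleOf N).mkQ.restrictScalars A)
      (N'.submoduleOf N).mkQ_surjective
  have : Module.Finite K (A ⧸ Ideal.span (Subtype.val ⁻¹' Set.range f)) :=
    finite_quotient_span_of_adjoin_eq_top Algebra.adjoin_adjoin_coe_preimage
  refine finite_of_annihilator_le (I := Ideal.span ((↑) ⁻¹' Set.range f : Set A))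
    (Ideal.span_le.mpr ?_)
  rintro a ⟨i, hi⟩
  refine Module.mem_annihilator.mpr fun y => ?_
  obtain ⟨x, rfl⟩ := Submodule.mkQ_surjective _ y
  refine (Submodule.Quotient.mk_eq_zero _).mpr ?_
  have hax : (a : R) • (x : M) ∈ N' := hi ▸ hN i x x.2
  exact hax

theorem exists_finite_le_span_sup {f : ι → R} [Module.Finite (Algebra.adjoin K (Set.range f)) M]
    {N N' : Submodule R M} (hN : ∀ i, ∀ x ∈ N, f i • x ∈ N') :
    ∃ T : Set M, T.Finite ∧ N.restrictScalars K ≤ Submodule.span K T ⊔ N'.restrictScalars K := by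
  have := finite_quotient_submoduleOf (K := K) hN
  obtain ⟨S, hS, htop⟩ := exists_finite_span_sup_eq_top (K := K) (N'.submoduleOf N)
  refine ⟨Subtype.val '' S, hS.image _, fun x hx => ?_⟩
  obtain ⟨w, hw, y, hy, hwy⟩ :=
    Submodule.mem_sup.mp (htop ▸ Submodule.mem_top (x := (⟨x, hx⟩ : N)))
  rw [← show (w : M) + y = x from congrArg Subtype.val hwy]
  refine Submodule.add_mem_sup ?_ hy
  have hmap := Submodule.mem_map_of_mem (f := N.subtype.restrictScalars K) hw
  rwa [Submodule.map_span] at hmap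

variable {𝒜 : (Fin r → ℕ) → Submodule K R} {ℳ : (Fin r → ℤ) → Submodule K M}
  [DirectSum.Decomposition ℳ]

theorem hilbertPowerSeries_sub_mem_polynomialSubring (c : Fin r → ℤ) {f : ι → R}
    [Module.Finite (Algebra.adjoin K (Set.range f)) M] {N N' : Submodule R M}
    (hN' : N'.IsHomogeneous ℳ) (hle : N' ≤ N) (hN : ∀ i, ∀ x ∈ N, f i • x ∈ N') :
    hilbertPowerSeries c ℳ N - hilbertPowerSeries c ℳ N' ∈ polynomialSubring (Fin r) ℤ := by
  obtain ⟨T, hT, hNT⟩ := exists_finite_le_span_sup (K := K) hN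
  have hinj : Function.Injective fun (a : Fin r →₀ ℕ) i => (a i : ℤ) + c i := fun a b hab =>
    Finsupp.ext fun i => by simpa using congrFun hab i
  refine mem_polynomialSubring_iff.mpr
    (((finite_setOf_hilbertSeries_ne hN' hle hT hNT).preimage hinj.injOn).subset fun a ha => ?_)
  rw [Set.mem_ofPred_eq, map_sub, sub_ne_zero] at ha
  exact ha

theorem prod_mul_hilbertPowerSeries_sub_mem_polynomialSubring [SetLike.GradedSMul 𝒜 ℳ]
    [∀ d, FiniteDimensional K (ℳ d)] {c : Fin r → ℤ} (hc : ∀ d, ℳ d ≠ ⊥ → c ≤ d)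
    {f : ι → R} {δ : ι → Fin r → ℕ} (hf : ∀ i, f i ∈ 𝒜 (δ i))
    [Module.Finite (Algebra.adjoin K (Set.range f)) M] (S : Finset ι) {N N' : Submodule R M}
    (hN : N.IsHomogeneous ℳ) (hN' : N'.IsHomogeneous ℳ) (hle : N' ≤ N)
    (h : ∀ i ∉ S, ∀ x ∈ N, f i • x ∈ N') :
    ((∏ i ∈ S, (1 - tpow (δ i)) : MvPolynomial (Fin r) ℤ) : MvPowerSeries (Fin r) ℤ) *
      (hilbertPowerSeries c ℳ N - hilbertPowerSeries c ℳ N') ∈ polynomialSubring (Fin r) ℤ := by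
  classical
  induction S using Finset.induction_on generalizing N N' with
  | empty =>
    rw [Finset.prod_empty, MvPolynomial.coe_one, one_mul]
    exact hilbertPowerSeries_sub_mem_polynomialSubring c hN' hle fun i =>
      h i (Finset.notMem_empty i)
  | insert i S hi ih =>
    have hcoker := ih (N := N) (N' := N.map (f i • LinearMap.id) ⊔ N') hN
      (isHomogeneous_sup ℳ (isHomogeneous_map_smul hN (hf i)) hN')
      (sup_le (Submodule.map_le_iff_le_comap.mpr fun x hx => N.smul_mem _ hx) hle)
      fun j hj x hx => by
        obtain rfl | hij := eq_or_ne j i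
        · exact Submodule.mem_sup_left ⟨x, hx, rfl⟩
        · exact Submodule.mem_sup_right (h j (by simp [hij, hj]) x hx)
    have hker := ih (N := N ⊓ N'.comap (f i • LinearMap.id)) (N' := N')
      (isHomogeneous_inf_comap_smul hN hN' (hf i)) hN'
      (le_inf hle fun x hx => N'.smul_mem (f i) hx) fun j hj x hx => by
        obtain rfl | hij := eq_or_ne j i
        · exact hx.2
        · exact h j (by simp [hij, hj]) x hx.1
    have hexact := tpow_mul_hilbertPowerSeries_sub hc hN hN' (hf i)
    convert sub_mem hcoker (mul_mem (coe_mem_polynomialSubring (tpow (δ i))) hker) using 1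
    have hcoe : ((1 - tpow (δ i) : MvPolynomial (Fin r) ℤ) : MvPowerSeries (Fin r) ℤ) =
        1 - tpow (δ i) :=
      (map_sub MvPolynomial.coeToMvPowerSeries.ringHom 1 (tpow (δ i))).trans (by simp)
    rw [Finset.prod_insert hi, MvPolynomial.coe_mul, hcoe]
    linear_combination
      (-((∏ i ∈ S, (1 - tpow (δ i)) : MvPolynomial (Fin r) ℤ) : MvPowerSeries (Fin r) ℤ)) * hexact

end HilbertSerre

section PrimeAvoidance

variable {ι S R : Type*} [AddMonoid ι] [CommRing R] [SetLike S R]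

section

variable {𝒜 : ι → S} [SetLike.GradedMonoid 𝒜]

theorem exists_homogeneous_notMem_and_forall_mem {e : ι} {q : Ideal R} [q.IsPrime]
    (hq : ∃ k ≠ 0, ∃ u ∈ 𝒜 (k • e), u ∉ q) (s : Finset (Ideal R))
    (hs : ∀ p ∈ s, ∃ k : ℕ, ∃ u ∈ 𝒜 (k • e), u ∈ p ∧ u ∉ q) :
    ∃ k ≠ 0, ∃ g ∈ 𝒜 (k • e), g ∉ q ∧ ∀ p ∈ s, g ∈ p := by
  classical
  induction s using Finset.induction_on with
  | empty =>
    obtain ⟨k, hk, u, hu, huq⟩ := hq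
    exact ⟨k, hk, u, hu, huq, by simp⟩
  | insert p s _ ih =>
    obtain ⟨k, hk, g, hg, hgq, hgs⟩ := ih fun p hp => hs p (Finset.mem_insert_of_mem hp)
    obtain ⟨l, u, hu, hup, huq⟩ := hs p (Finset.mem_insert_self p s)
    refine ⟨k + l, by omega, g * u, ?_, ?_, ?_⟩
    · exact add_nsmul e k l ▸ SetLike.mul_mem_graded hg hu
    · exact fun h => (Ideal.IsPrime.mem_or_mem ‹_› h).elim hgq huq
    · exact Finset.forall_mem_insert .. |>.mpr
        ⟨Ideal.mul_mem_left p g hup, fun p₁ hp₁ => Ideal.mul_mem_right u p₁ (hgs p₁ hp₁)⟩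

theorem pow_add_pow_notMem {p : Ideal R} [p.IsPrime] {f g : R} {k l : ℕ} (hk : k ≠ 0) (hl : l ≠ 0)
    (hfg : f ∈ p ↔ g ∉ p) : f ^ l + g ^ k ∉ p := by
  intro h
  by_cases hf : f ∈ p
  · have := (Ideal.add_mem_iff_right p (Ideal.pow_mem_of_mem p hf l (Nat.pos_of_ne_zero hl))).mp h
    exact hfg.mp hf (Ideal.IsPrime.mem_of_pow_mem ‹_› k this)
  · have hg : g ∈ p := not_not.mp (mt hfg.mpr hf)
    have := (Ideal.add_mem_iff_left p (Ideal.pow_mem_of_mem p hg k (Nat.pos_of_ne_zero hk))).mp h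
    exact hf (Ideal.IsPrime.mem_of_pow_mem ‹_› l this)

end

variable (𝒜 : ι → S) [AddSubmonoidClass S R] [SetLike.GradedMonoid 𝒜]

theorem exists_homogeneous_notMem_of_isPrime {e : ι} (s : Finset (Ideal R))
    (hprime : ∀ p ∈ s, p.IsPrime) (hs : ∀ p ∈ s, ∃ k ≠ 0, ∃ u ∈ 𝒜 (k • e), u ∉ p) :
    ∃ k ≠ 0, ∃ f ∈ 𝒜 (k • e), ∀ p ∈ s, f ∉ p := by
  classical
  induction s using Finset.strongInduction with
  | H s ih =>
  obtain rfl | ⟨q, hq⟩ := s.eq_empty_or_nonempty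
  · exact ⟨1, one_ne_zero, 0, zero_mem _, by simp⟩
  have := hprime q hq
  have avoid_erase : ∀ p ∈ s, ∃ k ≠ 0, ∃ f ∈ 𝒜 (k • e), ∀ p' ∈ s, p' ≠ p → f ∉ p' := by
    intro p hp
    obtain ⟨k, hk, f, hf, hfs⟩ := ih (s.erase p) (Finset.erase_ssubset hp)
      (fun p' hp' => hprime p' (Finset.mem_of_mem_erase hp'))
      fun p' hp' => hs p' (Finset.mem_of_mem_erase hp')
    exact ⟨k, hk, f, hf, fun p' hp' hne => hfs p' (Finset.mem_erase.mpr ⟨hne, hp'⟩)⟩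
  by_cases hcomp : ∃ p ∈ s.erase q, ∀ k : ℕ, ∀ x ∈ 𝒜 (k • e), x ∈ p → x ∈ q
  · obtain ⟨p, hp, hpq⟩ := hcomp
    obtain ⟨k, hk, f, hf, hfs⟩ := avoid_erase p (Finset.mem_of_mem_erase hp)
    refine ⟨k, hk, f, hf, fun p' hp' => ?_⟩
    obtain rfl | hne := eq_or_ne p' p
    · exact fun hfp => hfs q hq (Finset.ne_of_mem_erase hp).symm (hpq k f hf hfp)
    · exact hfs p' hp' hne
  · push Not at hcomp
    obtain ⟨k, hk, f, hf, hfs⟩ := avoid_erase q hq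
    by_cases hfq : f ∈ q
    · obtain ⟨l, hl, g, hg, hgq, hgs⟩ :=
        exists_homogeneous_notMem_and_forall_mem (hs q hq) (s.erase q) hcomp
      -- In contrast to `f + g`, the element `f ^ l + g ^ k` is homogeneous.
      refine ⟨l * k, mul_ne_zero hl hk, f ^ l + g ^ k, add_mem ?_ ?_, fun p hp => ?_⟩
      · exact mul_nsmul' e l k ▸ SetLike.pow_mem_graded l hf
      · exact mul_nsmul e l k ▸ SetLike.pow_mem_graded k hg
      · have := hprime p hp
        refine pow_add_pow_notMem hk hl ?_
        obtain rfl | hne := eq_or_ne p q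
        · exact iff_of_true hfq hgq
        · exact iff_of_false (hfs p hp hne) (not_not.mpr (hgs p (Finset.mem_erase.mpr ⟨hne, hp⟩)))
    · refine ⟨k, hk, f, hf, fun p hp => ?_⟩
      obtain rfl | hne := eq_or_ne p q
      exacts [hfq, hfs p hp hne]

end PrimeAvoidance

section KrullDimension

theorem isMaximal_of_finite_quotient (K : Type*) {R : Type*} [Field K] [CommRing R] [Algebra K R]
    (p : Ideal R) [p.IsPrime] [Module.Finite K (R ⧸ p)] : p.IsMaximal := by
  have : IsArtinianRing (R ⧸ p) := IsArtinianRing.of_finite K _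
  exact Ideal.Quotient.maximal_of_isField p (IsArtinianRing.isField_of_isDomain _)

theorem ringKrullDim_quotient_sup_span_singleton_le {R : Type*} [CommRing R] {I : Ideal R} {m : ℕ}
    (hm : ringKrullDim (R ⧸ I) ≤ (m + 1 : ℕ)) {f : R}
    (hf : ∀ p ∈ I.minimalPrimes, f ∈ p → p.IsMaximal) :
    ringKrullDim (R ⧸ (I ⊔ Ideal.span {f})) ≤ m := by
  rw [ringKrullDim_quotient] at hm ⊢
  refine iSup_le fun l => ?_
  have hl : I ⊔ Ideal.span {f} ≤ l.head.1.asIdeal := l.head.2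
  have := l.head.1.isPrime
  obtain ⟨p, hp, hpl⟩ := Ideal.exists_minimalPrimes_le (le_sup_left.trans hl)
  obtain hlt | rfl := hpl.lt_or_eq
  · have hle : PrimeSpectrum.zeroLocus ((I ⊔ Ideal.span {f} : Ideal R) : Set R) ⊆
        PrimeSpectrum.zeroLocus (I : Set R) := PrimeSpectrum.zeroLocus_anti_mono_ideal le_sup_left
    let l' : LTSeries (PrimeSpectrum.zeroLocus (I : Set R)) :=
      l.map (Set.inclusion hle) fun _ _ h => h
    let p' : PrimeSpectrum.zeroLocus (I : Set R) := ⟨⟨p, hp.1.1⟩, hp.1.2⟩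
    have hlen := (Order.LTSeries.length_le_krullDim (l'.cons p' hlt)).trans hm
    have hcons : (l'.cons p' hlt).length = l.length + 1 := RelSeries.cons_length l' p' hlt
    rw [hcons] at hlen
    have : l.length + 1 ≤ m + 1 := by exact_mod_cast hlen
    exact_mod_cast Nat.le_of_succ_le_succ this
  · have hmax := hf _ hp (hl (Submodule.mem_sup_right (Ideal.mem_span_singleton_self f)))
    have hlen : l.length = 0 := by
      by_contra h0
      have hlt : l.head < l.last := l.strictMono (Fin.pos_iff_ne_zero.mpr fun h =>
        h0 (by simpa using h))
      exact l.last.1.isPrime.ne_top (hmax.1.2 _ hlt)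
    rw [hlen]
    exact_mod_cast Nat.zero_le m

theorem ringKrullDim_ne_top_of_finiteType (K R : Type*) [Field K] [CommRing R] [Algebra K R]
    [Algebra.FiniteType K R] : ringKrullDim R ≠ ⊤ := by
  obtain ⟨n, g, hg⟩ := Algebra.FiniteType.iff_quotient_mvPolynomial''.mp ‹_›
  have hle : ringKrullDim R ≤ (n : ℕ∞) := by
    simpa [MvPolynomial.ringKrullDim_of_isNoetherianRing, ringKrullDim_eq_zero_of_field]
      using ringKrullDim_le_of_surjective g.toRingHom hg
  intro h
  rw [h] at hle
  exact ENat.natCast_ne_top n (top_le_iff.mp (WithBot.coe_le_coe.mp hle))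

end KrullDimension

section Parameters

variable {K R : Type*} [Field K] [CommRing R] [Algebra K R]

theorem finite_quotient_of_forall_mem {ι : Type*} [DecidableEq ι] [AddMonoid ι]
    (𝒜 : ι → Submodule K R) [GradedAlgebra 𝒜] [FiniteDimensional K (𝒜 0)] {I : Ideal R}
    (hI : ∀ d ≠ 0, ∀ x ∈ 𝒜 d, x ∈ I) : Module.Finite K (R ⧸ I) := by
  refine Module.Finite.of_surjective ((Ideal.Quotient.mkₐ K I).toLinearMap ∘ₗ (𝒜 0).subtype)
    fun y => ?_
  obtain ⟨x, rfl⟩ := Ideal.Quotient.mk_surjective y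
  refine ⟨DirectSum.decompose 𝒜 x 0, Ideal.Quotient.eq.mpr ?_⟩
  change proj 𝒜 0 x - x ∈ I
  refine mem_of_forall_proj_mem 𝒜 fun d => ?_
  obtain rfl | hd := eq_or_ne d 0
  · rw [map_sub, proj_of_mem 𝒜 (proj_mem 𝒜 0 x), sub_self]
    exact I.zero_mem
  · rw [map_sub, proj_of_mem_of_ne 𝒜 (proj_mem 𝒜 0 x) hd.symm, zero_sub]
    exact I.neg_mem (hI d hd _ (proj_mem 𝒜 d x))

variable {r : ℕ} (𝒜 : (Fin r → ℕ) → Submodule K R)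

theorem mem_idealI {d e : Fin r → ℕ} (h : ¬ VecDvd e d) {x : R} (hx : x ∈ 𝒜 d) : x ∈ idealI 𝒜 e :=
  Ideal.subset_span ⟨d, h, hx⟩

variable [GradedAlgebra 𝒜] [FiniteDimensional K (𝒜 0)]

theorem isMaximal_of_idealI_le {e : Fin r → ℕ} {p : Ideal R} [p.IsPrime] (hp : idealI 𝒜 e ≤ p)
    (h : ∀ k ≠ 0, ∀ u ∈ 𝒜 (k • e), u ∈ p) : p.IsMaximal := by
  have : Module.Finite K (R ⧸ p) := by
    refine finite_quotient_of_forall_mem 𝒜 fun d hd x hx => ?_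
    by_cases hed : VecDvd e d
    · obtain ⟨k, rfl⟩ := hed
      exact h k (fun hk => hd (by rw [hk, zero_nsmul])) x hx
    · exact hp (mem_idealI 𝒜 hed hx)
  exact isMaximal_of_finite_quotient K p

variable [Algebra.FiniteType K R]

theorem exists_homogeneous_ringKrullDim_quotient_sup_span_le {e : Fin r → ℕ} {I : Ideal R}
    (hI : idealI 𝒜 e ≤ I) {m : ℕ} (hm : ringKrullDim (R ⧸ I) ≤ (m + 1 : ℕ)) :
    ∃ k ≠ 0, ∃ f ∈ 𝒜 (k • e), ringKrullDim (R ⧸ (I ⊔ Ideal.span {f})) ≤ m := by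
  classical
  have : IsNoetherianRing R := Algebra.FiniteType.isNoetherianRing K R
  have hfin : I.minimalPrimes.Finite := Ideal.finite_minimalPrimes_of_isNoetherianRing R I
  obtain ⟨k, hk, f, hf, hfp⟩ := exists_homogeneous_notMem_of_isPrime 𝒜 (e := e)
    (hfin.toFinset.filter fun p => ∃ k ≠ 0, ∃ u ∈ 𝒜 (k • e), u ∉ p)
    (fun p hp => (hfin.mem_toFinset.mp (Finset.mem_filter.mp hp).1).1.1)
    fun p hp => (Finset.mem_filter.mp hp).2
  refine ⟨k, hk, f, hf, ringKrullDim_quotient_sup_span_singleton_le hm fun p hp hfmem => ?_⟩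
  have := hp.1.1
  refine isMaximal_of_idealI_le 𝒜 (hI.trans hp.1.2) ?_
  by_contra! h
  exact hfp p (Finset.mem_filter.mpr ⟨hfin.mem_toFinset.mpr hp, h⟩) hfmem

theorem exists_homogeneous_parameters {e : Fin r → ℕ} (m : ℕ) {I : Ideal R} (hI : idealI 𝒜 e ≤ I)
    (hm : ringKrullDim (R ⧸ I) ≤ m) :
    ∃ (f : Fin m → R) (k : Fin m → ℕ), (∀ i, k i ≠ 0) ∧ (∀ i, f i ∈ 𝒜 (k i • e)) ∧
      Module.Finite K (R ⧸ (I ⊔ Ideal.span (Set.range f))) := by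
  induction m generalizing I with
  | zero =>
    refine ⟨Fin.elim0, Fin.elim0, fun i => i.elim0, fun i => i.elim0, ?_⟩
    rwa [Set.range_eq_empty, Ideal.span_empty, sup_bot_eq, Module.finite_iff_krullDimLE_zero,
      Ring.KrullDimLE, Order.krullDimLE_iff]
  | succ m ih =>
    obtain ⟨k, hk, f, hf, hdim⟩ := exists_homogeneous_ringKrullDim_quotient_sup_span_le 𝒜 hI hm
    obtain ⟨f', k', hk', hf', hfinite⟩ := ih (hI.trans le_sup_left) hdim
    refine ⟨Fin.cons f f', Fin.cons k k', Fin.cases hk hk', Fin.cases hf hf', ?_⟩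
    rwa [Fin.range_cons, Ideal.span_insert, ← sup_assoc]

end Parameters

section Systems

variable {K R M : Type*} [Field K] [CommRing R] [Algebra K R] [AddCommGroup M]
  [Module R M] {r : ℕ} (𝒜 : (Fin r → ℕ) → Submodule K R)

theorem suppDim_eq [Module.Finite R M] (e : Fin r → ℕ) :
    suppDim 𝒜 M e = ringKrullDim (R ⧸ (Module.annihilator R M ⊔ idealI 𝒜 e)) := by
  rw [ringKrullDim_quotient, suppDim, Module.supportDim, Module.support_quotient,
    Module.support_eq_zeroLocus, ← PrimeSpectrum.zeroLocus_sup]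

theorem mult_le_of_suppDim_le {e : Fin r → ℕ} {n : ℕ} (h : suppDim 𝒜 M e ≤ n) :
    mult 𝒜 M e ≤ n :=
  ENat.toNat_le_of_le_natCast (WithBot.unbotD_le_iff (fun _ => bot_le) |>.mpr h)

theorem mult_eq_zero_of_finite [Module.Finite R M] {e : Fin r → ℕ}
    [Module.Finite K (R ⧸ (Module.annihilator R M ⊔ idealI 𝒜 e))] : mult 𝒜 M e = 0 := by
  have hdim := (Module.finite_iff_krullDimLE_zero K (R ⧸ (Module.annihilator R M ⊔ idealI 𝒜 e))).mp
    inferInstance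
  rw [Ring.KrullDimLE, Order.krullDimLE_iff] at hdim
  exact Nat.le_zero.mp (mult_le_of_suppDim_le 𝒜 ((suppDim_eq 𝒜 e).trans_le hdim))

theorem suppDim_ne_top [Algebra.FiniteType K R] (e : Fin r → ℕ) : suppDim 𝒜 M e ≠ ⊤ :=
  ne_top_of_le_ne_top (ringKrullDim_ne_top_of_finiteType K R)
    (Module.supportDim_le_ringKrullDim R _)

theorem suppDim_eq_mult [Algebra.FiniteType K R] {e : Fin r → ℕ} (h : suppDim 𝒜 M e ≠ ⊥) :
    suppDim 𝒜 M e = (mult 𝒜 M e : ℕ∞) := by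
  obtain ⟨n, hn⟩ := WithBot.ne_bot_iff_exists.mp h
  have htop : n ≠ ⊤ := fun hn' => suppDim_ne_top 𝒜 (M := M) e (by rw [← hn, hn']; rfl)
  rw [mult, ← hn, WithBot.unbotD_coe, ENat.natCast_toNat htop]

theorem suppDim_le_mult [Algebra.FiniteType K R] (e : Fin r → ℕ) :
    suppDim 𝒜 M e ≤ (mult 𝒜 M e : ℕ∞) := by
  obtain h | h := eq_or_ne (suppDim 𝒜 M e) ⊥
  exacts [h ▸ bot_le, (suppDim_eq_mult 𝒜 h).le]

theorem exists_finset_span_eq_idealI [IsNoetherianRing R] (e : Fin r → ℕ) :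
    ∃ G : Finset R, (∀ x ∈ G, ∃ d, ¬ VecDvd e d ∧ x ∈ 𝒜 d) ∧
      Ideal.span (G : Set R) = idealI 𝒜 e := by
  obtain ⟨G, hG, hspan⟩ := (Submodule.fg_span_iff_fg_span_finset_subset _).mp
    (IsNoetherian.noetherian (idealI 𝒜 e))
  exact ⟨G, hG, hspan.symm⟩

theorem vecDvd_zero_iff {d : Fin r → ℕ} : VecDvd 0 d ↔ d = 0 := by simp [VecDvd]

variable [GradedAlgebra 𝒜] [Algebra.FiniteType K R] [FiniteDimensional K (𝒜 0)]

omit [Algebra.FiniteType K R] in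
theorem mult_zero [Module.Finite R M] : mult 𝒜 M 0 = 0 := by
  have : Module.Finite K (R ⧸ (Module.annihilator R M ⊔ idealI 𝒜 0)) :=
    finite_quotient_of_forall_mem 𝒜 fun d hd x hx =>
      Submodule.mem_sup_right (mem_idealI 𝒜 (mt vecDvd_zero_iff.mp hd) hx)
  exact mult_eq_zero_of_finite 𝒜

variable (M) in
/-- The elements of `G` generate `I^{[e]}`, and the `f i` are parameters modulo `I^{[e]}`. -/
theorem exists_parameters_of_mult [Module.Finite R M] (e : Fin r → ℕ) :
    ∃ (G : Finset R) (f : Fin (mult 𝒜 M e) → R) (k : Fin (mult 𝒜 M e) → ℕ) (η : G → Fin r → ℕ),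
      (∀ i, k i ≠ 0) ∧ (∀ g, ¬ VecDvd e (η g)) ∧
      (∀ j, Sum.elim f (↑) j ∈ 𝒜 (Sum.elim (fun i => k i • e) η j)) ∧
      (∀ j, Sum.elim (fun i => k i • e) η j ≠ 0) ∧
      Module.Finite K (R ⧸ (Module.annihilator R M ⊔
        Ideal.span (Set.range (Sum.elim f ((↑) : G → R))))) := by
  have : IsNoetherianRing R := Algebra.FiniteType.isNoetherianRing K R
  obtain ⟨G, hG, hspan⟩ := exists_finset_span_eq_idealI 𝒜 e
  choose! η hη hGη using hG
  obtain ⟨f, k, hk, hf, hfin⟩ := exists_homogeneous_parameters 𝒜 (e := e) (mult 𝒜 M e) le_sup_right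
    ((suppDim_eq 𝒜 (M := M) e).symm.le.trans (suppDim_le_mult 𝒜 e))
  have he : mult 𝒜 M e ≠ 0 → e ≠ 0 := by
    rintro h rfl
    exact h (mult_zero 𝒜)
  refine ⟨G, f, k, fun g => η g, hk, fun g => hη g g.2, Sum.forall.mpr ⟨hf, fun g => hGη g g.2⟩,
    Sum.forall.mpr ⟨fun i => smul_ne_zero (hk i) (he (NeZero.of_pos i.pos).ne),
      fun g h => hη g g.2 ⟨0, h.trans (zero_nsmul e).symm⟩⟩, ?_⟩
  rwa [Set.Sum.elim_range, Ideal.span_union, Subtype.range_coe_subtype, Finset.setOfPred_mem, hspan,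
    sup_comm (Ideal.span _), ← sup_assoc]

theorem exists_irrelevant_parameters :
    ∃ (G : Finset R) (η : G → Fin r → ℕ), (∀ g, η g ≠ 0) ∧ (∀ g : G, (g : R) ∈ 𝒜 (η g)) ∧
      ∀ I : Ideal R, Ideal.span (Set.range ((↑) : G → R)) ≤ I → Module.Finite K (R ⧸ I) := by
  have : IsNoetherianRing R := Algebra.FiniteType.isNoetherianRing K R
  obtain ⟨G, hG, hspan⟩ := exists_finset_span_eq_idealI 𝒜 0
  choose! η hη hGη using hG
  refine ⟨G, fun g => η g, fun g h => hη g g.2 (vecDvd_zero_iff.mpr h), fun g => hGη g g.2,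
    fun I hI => finite_quotient_of_forall_mem 𝒜 fun d hd x hx => hI ?_⟩
  rw [Subtype.range_coe_subtype, Finset.setOfPred_mem, hspan]
  exact mem_idealI 𝒜 (fun h => hd (vecDvd_zero_iff.mp h)) hx

variable (M) in
theorem finite_setOf_mult_ne_zero [Module.Finite R M] : {e | mult 𝒜 M e ≠ 0}.Finite := by
  obtain ⟨G, η, hη, hG, hfin⟩ := exists_irrelevant_parameters 𝒜
  refine (Set.finite_iUnion fun g : G => finite_setOf_vecDvd (hη g)).subset fun e he => ?_
  by_contra hne
  have : Module.Finite K (R ⧸ (Module.annihilator R M ⊔ idealI 𝒜 e)) := by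
    refine hfin _ (le_sup_of_le_right (Ideal.span_le.mpr ?_))
    rintro _ ⟨g, rfl⟩
    exact mem_idealI 𝒜 (fun h => hne (Set.mem_iUnion.mpr ⟨g, h⟩)) (hG g)
  exact he (mult_eq_zero_of_finite 𝒜)

end Systems

section Growth

open PowerSeries

theorem coeff_eq_sum_coeff_one_sub_X_mul (G : ℤ⟦X⟧) (n : ℕ) :
    coeff n G = ∑ k ∈ Finset.range (n + 1), coeff k ((1 - X) * G) := by
  induction n with
  | zero => simp [sub_mul]
  | succ n ih =>
    rw [Finset.sum_range_succ, ← ih, sub_mul, one_mul, map_sub, coeff_succ_X_mul]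
    ring

theorem exists_abs_sum_coeff_le_of_polynomial (P : Polynomial ℤ) :
    ∃ C : ℕ, ∀ n, |∑ k ∈ Finset.range n, P.coeff k| ≤ C := by
  refine ⟨∑ k ∈ P.support, (P.coeff k).natAbs, fun n => (Finset.abs_sum_le_sum_abs _ _).trans ?_⟩
  push_cast
  rw [← Finset.sum_filter_of_ne (p := (· ∈ P.support)) fun k _ hk => by simpa using hk]
  exact Finset.sum_le_sum_of_subset_of_nonneg (fun k hk => (Finset.mem_filter.mp hk).2)
    fun _ _ _ => abs_nonneg _

theorem exists_abs_sum_coeff_le (m : ℕ) {G : ℤ⟦X⟧} {P : Polynomial ℤ}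
    (h : (1 - X) ^ m * G = (P : ℤ⟦X⟧)) :
    ∃ C : ℕ, ∀ n : ℕ, |∑ k ∈ Finset.range (n + 1), coeff k G| ≤ C * (n + 1) ^ m := by
  induction m generalizing G with
  | zero =>
    obtain ⟨C, hC⟩ := exists_abs_sum_coeff_le_of_polynomial P
    refine ⟨C, fun n => ?_⟩
    simpa [show G = P by simpa using h] using hC (n + 1)
  | succ m ih =>
    obtain ⟨C, hC⟩ := ih (G := (1 - X) * G) (by rw [← h, pow_succ, mul_assoc])
    refine ⟨C, fun n => (Finset.abs_sum_le_sum_abs _ _).trans ?_⟩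
    calc ∑ k ∈ Finset.range (n + 1), |coeff k G|
        ≤ ∑ k ∈ Finset.range (n + 1), (C : ℤ) * (n + 1) ^ m := by
          refine Finset.sum_le_sum fun k hk => ?_
          have hkn : k ≤ n := Nat.lt_succ_iff.mp (Finset.mem_range.mp hk)
          rw [coeff_eq_sum_coeff_one_sub_X_mul]
          exact (hC k).trans (by gcongr)
      _ = C * (n + 1) ^ (m + 1) := by
          rw [Finset.sum_const, Finset.card_range, nsmul_eq_mul, pow_succ]
          push_cast
          ring

theorem le_coeff_prod_geom_mul {ι : Type*} (S : Finset ι) {a : ι → ℕ} (ha : ∀ i, a i ≠ 0)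
    {h : ℤ⟦X⟧} (hh : ∀ k, 0 ≤ coeff k h) (k : ℕ) :
    coeff k h ≤ coeff k ((∏ i ∈ S, ∑ j ∈ Finset.range (a i), (X : ℤ⟦X⟧) ^ j) * h) := by
  classical
  induction S using Finset.induction_on generalizing k with
  | empty => simp
  | insert i S hi ih =>
    refine (ih k).trans ?_
    rw [Finset.prod_insert hi, mul_assoc]
    set h' := (∏ i ∈ S, ∑ j ∈ Finset.range (a i), (X : ℤ⟦X⟧) ^ j) * h
    have hh' (k : ℕ) : 0 ≤ coeff k h' := (hh k).trans (ih k)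
    rw [Finset.sum_mul, map_sum]
    have hterm : ∀ j ∈ Finset.range (a i), 0 ≤ coeff k ((X : ℤ⟦X⟧) ^ j * h') := fun j _ => by
      rw [coeff_X_pow_mul']
      split_ifs
      exacts [hh' _, le_rfl]
    simpa using Finset.single_le_sum hterm (Finset.mem_range.mpr (Nat.pos_of_ne_zero (ha i)))

theorem coe_prod_one_sub_X_pow {m : ℕ} (a : Fin m → ℕ) :
    ((∏ i, (1 - Polynomial.X ^ a i) : Polynomial ℤ) : ℤ⟦X⟧) =
      (1 - X) ^ m * ∏ i, ∑ j ∈ Finset.range (a i), (X : ℤ⟦X⟧) ^ j := by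
  have hpow : (1 - X : ℤ⟦X⟧) ^ m = ∏ _i : Fin m, (1 - X) := by simp
  rw [← Polynomial.coeToPowerSeries.ringHom_apply, map_prod, hpow, ← Finset.prod_mul_distrib]
  simp [mul_neg_geom_sum]

theorem exists_mul_pow_lt_succ_pow (C A m : ℕ) :
    ∃ n : ℕ, C * (A * n + 1) ^ m < (n + 1) ^ (m + 1) := by
  refine ⟨C * (A + 1) ^ m, ?_⟩
  set n := C * (A + 1) ^ m with hn
  calc C * (A * n + 1) ^ m ≤ C * ((A + 1) * (n + 1)) ^ m := by gcongr; nlinarith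
    _ = n * (n + 1) ^ m := by rw [mul_pow, hn]; ring
    _ < (n + 1) ^ (m + 1) := by rw [pow_succ']; gcongr; exact n.lt_succ_self

/-- If `P(1) = 0`, then `h` is dominated by a series with denominator `(1 - X)^{m - 1}`, the partial
sums of which are `O(n^{m - 1})`. -/
theorem eval_one_ne_zero_of_growth {m : ℕ} (hm : m ≠ 0) {a : Fin m → ℕ} (ha : ∀ i, a i ≠ 0)
    {h : ℤ⟦X⟧} (hh : ∀ k, 0 ≤ coeff k h) {P : Polynomial ℤ}
    (hP : ((∏ i, (1 - Polynomial.X ^ a i) : Polynomial ℤ) : ℤ⟦X⟧) * h = P) (A : ℕ)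
    (hA : ∀ n : ℕ, ((n : ℤ) + 1) ^ m ≤ ∑ k ∈ Finset.range (A * n + 1), coeff k h) :
    P.eval 1 ≠ 0 := by
  intro hP1
  obtain ⟨m, rfl⟩ := Nat.exists_eq_succ_of_ne_zero hm
  obtain ⟨P', rfl⟩ : 1 - Polynomial.X ∣ P := by
    rw [← neg_sub, neg_dvd]
    simpa using Polynomial.dvd_iff_isRoot.mpr hP1
  set Q : ℤ⟦X⟧ := ∏ i, ∑ j ∈ Finset.range (a i), (X : ℤ⟦X⟧) ^ j
  have hcancel : (1 - X) ^ m * (Q * h) = (P' : ℤ⟦X⟧) := by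
    have h1X : (1 - X : ℤ⟦X⟧) ≠ 0 := fun h0 => by simpa using congrArg constantCoeff h0
    have hcoe : ((1 - Polynomial.X : Polynomial ℤ) : ℤ⟦X⟧) = 1 - X := by
      rw [← Polynomial.coeToPowerSeries.ringHom_apply, map_sub, map_one,
        Polynomial.coeToPowerSeries.ringHom_apply, Polynomial.coe_X]
    refine mul_left_cancel₀ h1X ?_
    rw [← hcoe, ← Polynomial.coe_mul, ← hP, coe_prod_one_sub_X_pow, hcoe, pow_succ']
    ring
  obtain ⟨C, hC⟩ := exists_abs_sum_coeff_le m hcancel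
  obtain ⟨n, hn⟩ := exists_mul_pow_lt_succ_pow C A m
  have : ((n : ℤ) + 1) ^ (m + 1) ≤ C * (A * n + 1) ^ m := calc
    _ ≤ ∑ k ∈ Finset.range (A * n + 1), coeff k h := hA n
    _ ≤ ∑ k ∈ Finset.range (A * n + 1), coeff k (Q * h) :=
      Finset.sum_le_sum fun k _ => le_coeff_prod_geom_mul _ ha hh k
    _ ≤ C * (A * n + 1) ^ m := by exact_mod_cast (le_abs_self _).trans (hC (A * n))
  exact absurd this (not_le.mpr (by exact_mod_cast hn))

end Growth

section Ray

variable {r : ℕ}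

/-- The coefficients of `F` are supported on the ray `α + ℕ e`. -/
def SupportedOnRay (α e : Fin r → ℕ) (F : MvPowerSeries (Fin r) ℤ) : Prop :=
  ∀ a, MvPowerSeries.coeff a F ≠ 0 → ∃ k : ℕ, a = Finsupp.equivFunOnFinite.symm (α + k • e)

/-- The one-variable series of the coefficients of `F` on the ray `α + ℕ e`; it determines `F` when
`e ≠ 0` and `F` is supported on this ray. -/
noncomputable def raySeries (α e : Fin r → ℕ) (F : MvPowerSeries (Fin r) ℤ) : PowerSeries ℤ :=
  PowerSeries.mk fun k => MvPowerSeries.coeff (Finsupp.equivFunOnFinite.symm (α + k • e)) F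

variable {α e : Fin r → ℕ} {F G : MvPowerSeries (Fin r) ℤ}

theorem equivFunOnFinite_symm_add_succ_nsmul (α e : Fin r → ℕ) (k : ℕ) :
    Finsupp.equivFunOnFinite.symm (α + (k + 1) • e) =
      Finsupp.equivFunOnFinite.symm (α + k • e) + Finsupp.equivFunOnFinite.symm e := by
  ext i
  simp only [Finsupp.equivFunOnFinite_symm_apply_apply, Finsupp.add_apply, succ_nsmul, ← add_assoc,
    Pi.add_apply]

theorem coeff_tpow_mul (e : Fin r → ℕ) (F : MvPowerSeries (Fin r) ℤ) (a : Fin r →₀ ℕ) :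
    MvPowerSeries.coeff a ((tpow e : MvPowerSeries (Fin r) ℤ) * F) =
      if Finsupp.equivFunOnFinite.symm e ≤ a then
        MvPowerSeries.coeff (a - Finsupp.equivFunOnFinite.symm e) F else 0 := by
  rw [tpow_eq_monomial, MvPolynomial.coe_monomial, MvPowerSeries.coeff_monomial_mul]
  simp only [one_mul]

theorem SupportedOnRay.add (hF : SupportedOnRay α e F) (hG : SupportedOnRay α e G) :
    SupportedOnRay α e (F + G) := by
  intro a ha
  by_cases h : MvPowerSeries.coeff a F = 0
  · exact hG a fun h' => ha (by rw [map_add, h, h', add_zero])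
  · exact hF a h

theorem SupportedOnRay.C_mul (hF : SupportedOnRay α e F) (c : ℤ) :
    SupportedOnRay α e (MvPowerSeries.C c * F) := fun a ha =>
  hF a (right_ne_zero_of_mul (MvPowerSeries.coeff_C_mul (σ := Fin r) a F c ▸ ha))

theorem SupportedOnRay.tpow_mul (hF : SupportedOnRay α e F) :
    SupportedOnRay α e ((tpow e : MvPowerSeries (Fin r) ℤ) * F) := by
  intro a ha
  rw [coeff_tpow_mul] at ha
  split_ifs at ha with h
  · obtain ⟨k, hk⟩ := hF _ ha
    exact ⟨k + 1, by rw [← tsub_add_cancel_of_le h, hk, equivFunOnFinite_symm_add_succ_nsmul]⟩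
  · exact absurd rfl ha

theorem raySeries_add : raySeries α e (F + G) = raySeries α e F + raySeries α e G := by
  ext k
  simp [raySeries]

theorem raySeries_C_mul (c : ℤ) :
    raySeries α e (MvPowerSeries.C c * F) = PowerSeries.C c * raySeries α e F := by
  ext k
  rw [raySeries, PowerSeries.coeff_mk, MvPowerSeries.coeff_C_mul, PowerSeries.coeff_C_mul,
    raySeries, PowerSeries.coeff_mk]

theorem raySeries_tpow_mul (he : e ≠ 0) (hF : SupportedOnRay α e F) :
    raySeries α e ((tpow e : MvPowerSeries (Fin r) ℤ) * F) = PowerSeries.X * raySeries α e F := by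
  ext k
  rw [raySeries, PowerSeries.coeff_mk, coeff_tpow_mul]
  cases k with
  | zero =>
    rw [PowerSeries.coeff_zero_X_mul, ite_eq_right_iff]
    intro h
    by_contra h0
    obtain ⟨k, hk⟩ := hF _ h0
    obtain ⟨i, hi⟩ := Function.ne_iff.mp he
    have hcoord : α i + 0 * e i - e i = α i + k * e i := by simpa using DFunLike.congr_fun hk i
    have hle : e i ≤ α i + 0 * e i := h i
    have hpos : 0 < e i := Nat.pos_of_ne_zero hi
    omega
  | succ k =>
    rw [PowerSeries.coeff_succ_X_mul, raySeries, PowerSeries.coeff_mk,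
      equivFunOnFinite_symm_add_succ_nsmul, if_pos (by simp), add_tsub_cancel_right]

theorem aeval_tpow_C (e : Fin r → ℕ) (c : ℤ) :
    ((Polynomial.aeval (tpow e) (Polynomial.C c) : MvPolynomial (Fin r) ℤ) :
      MvPowerSeries (Fin r) ℤ) = MvPowerSeries.C c := by
  rw [Polynomial.aeval_C, MvPolynomial.algebraMap_eq, MvPolynomial.coe_C]

theorem aeval_tpow_monomial_succ (e : Fin r → ℕ) (n : ℕ) (c : ℤ) :
    Polynomial.aeval (tpow e) (Polynomial.C c * Polynomial.X ^ (n + 1)) =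
      tpow e * Polynomial.aeval (tpow e) (Polynomial.C c * Polynomial.X ^ n) := by
  rw [pow_succ', mul_left_comm, map_mul, Polynomial.aeval_X]

theorem SupportedOnRay.aeval_mul (hF : SupportedOnRay α e F) (q : Polynomial ℤ) :
    SupportedOnRay α e (((Polynomial.aeval (tpow e) q : MvPolynomial (Fin r) ℤ) :
      MvPowerSeries (Fin r) ℤ) * F) := by
  induction q using Polynomial.induction_on with
  | C c => exact aeval_tpow_C e c ▸ hF.C_mul c
  | add p q hp hq =>
    rw [map_add, MvPolynomial.coe_add, add_mul]
    exact hp.add hq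
  | monomial n c ih =>
    rw [aeval_tpow_monomial_succ, MvPolynomial.coe_mul, mul_assoc]
    exact ih.tpow_mul

theorem raySeries_aeval_mul (he : e ≠ 0) (hF : SupportedOnRay α e F) (q : Polynomial ℤ) :
    raySeries α e (((Polynomial.aeval (tpow e) q : MvPolynomial (Fin r) ℤ) :
      MvPowerSeries (Fin r) ℤ) * F) = (q : PowerSeries ℤ) * raySeries α e F := by
  induction q using Polynomial.induction_on with
  | C c => rw [aeval_tpow_C, raySeries_C_mul, Polynomial.coe_C]
  | add p q hp hq =>
    rw [map_add, MvPolynomial.coe_add, add_mul, Polynomial.coe_add, add_mul, raySeries_add, hp, hq]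
  | monomial n c ih =>
    rw [aeval_tpow_monomial_succ, MvPolynomial.coe_mul, mul_assoc,
      raySeries_tpow_mul he (hF.aeval_mul _), ih, pow_succ', mul_left_comm (Polynomial.C c),
      Polynomial.coe_mul Polynomial.X, Polynomial.coe_X, mul_assoc]

theorem exists_eq_tpow_mul_aeval {p : MvPolynomial (Fin r) ℤ}
    (hp : SupportedOnRay α e (p : MvPowerSeries (Fin r) ℤ)) :
    ∃ P : Polynomial ℤ, p = tpow α * Polynomial.aeval (tpow e) P := by
  have hterm : ∀ a ∈ p.support, ∃ P : Polynomial ℤ,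
      MvPolynomial.monomial a (p.coeff a) = tpow α * Polynomial.aeval (tpow e) P := by
    intro a ha
    obtain ⟨k, hk⟩ := hp a (by simpa using ha)
    refine ⟨Polynomial.C (p.coeff a) * Polynomial.X ^ k, ?_⟩
    conv_lhs => rw [← mul_one (p.coeff a), ← MvPolynomial.C_mul_monomial, hk, ← tpow_eq_monomial]
    rw [tpow_add, tpow_nsmul, map_mul, Polynomial.aeval_C, map_pow, Polynomial.aeval_X,
      MvPolynomial.algebraMap_eq, hk]
    ring
  choose! P hP using hterm
  refine ⟨∑ a ∈ p.support, P a, ?_⟩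
  rw [map_sum, Finset.mul_sum, ← Finset.sum_congr rfl hP, MvPolynomial.support_sum_monomial_coeff]

theorem supportedOnRay_tpow : SupportedOnRay α e (tpow α : MvPowerSeries (Fin r) ℤ) := by
  classical
  intro a ha
  rw [tpow_eq_monomial, MvPolynomial.coe_monomial, MvPowerSeries.coeff_monomial] at ha
  exact ⟨0, by simpa using ha⟩

theorem raySeries_tpow (he : e ≠ 0) :
    raySeries α e (tpow α : MvPowerSeries (Fin r) ℤ) = 1 := by
  classical
  ext k
  rw [raySeries, PowerSeries.coeff_mk, tpow_eq_monomial, MvPolynomial.coe_monomial,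
    MvPowerSeries.coeff_monomial, PowerSeries.coeff_one]
  refine if_congr ?_ rfl rfl
  rw [Finsupp.equivFunOnFinite.symm.injective.eq_iff, add_eq_left, smul_eq_zero_iff_left he]

theorem isRelPrime_phiVec_aeval (he : e ≠ 0) {P : Polynomial ℤ} (hP : P.eval 1 ≠ 0) :
    IsRelPrime (phiVec e) (Polynomial.aeval (tpow e) P) := by
  obtain ⟨S, hS⟩ := phiVec_dvd_one_sub_tpow he
  obtain ⟨Q, hQ⟩ : Polynomial.X - Polynomial.C 1 ∣ P - Polynomial.C (P.eval 1) :=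
    Polynomial.X_sub_C_dvd_sub_C_eval
  have hcomb := congrArg (Polynomial.aeval (tpow e)) hQ
  rw [map_sub, map_mul, map_sub, Polynomial.aeval_X, Polynomial.aeval_C, Polynomial.aeval_C,
    MvPolynomial.algebraMap_eq, map_one] at hcomb
  refine isRelPrime_of_mul_add_mul_eq_C (by simp [constantCoeff_phiVec]) hP
    (a := S * Polynomial.aeval (tpow e) Q) (b := 1) ?_
  linear_combination hcomb - Polynomial.aeval (tpow e) Q * hS

theorem phiVec_pow_dvd_prod_one_sub_tpow (he : e ≠ 0) {m : ℕ} (a : Fin m → ℕ) :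
    phiVec e ^ m ∣ ∏ i, (1 - tpow (a i • e)) := by
  have := Finset.prod_dvd_prod_of_dvd (s := Finset.univ) (fun _ : Fin m => phiVec e) _
    fun i _ => (phiVec_dvd_one_sub_tpow he).trans (one_sub_tpow_dvd (a i) e)
  simpa using this

theorem prod_one_sub_tpow_nsmul {m : ℕ} (a : Fin m → ℕ) :
    ∏ i, (1 - tpow (a i • e)) =
      Polynomial.aeval (tpow e) (∏ i, (1 - Polynomial.X ^ a i) : Polynomial ℤ) := by
  simp only [map_prod, map_sub, map_one, map_pow, Polynomial.aeval_X, tpow_nsmul]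

/-- `F` equals `t^α P(t^e) / ∏ (1 - t^{a_i e})`, where `P(1) ≠ 0` by the growth of its coefficients,
so that its numerator is relatively prime to `φ_e`. -/
theorem phiVec_pow_dvd_of_growth (he : e ≠ 0) (hF : SupportedOnRay α e F) {m : ℕ} (hm : m ≠ 0)
    {a : Fin m → ℕ} (ha : ∀ i, a i ≠ 0)
    (hpoly : ((∏ i, (1 - tpow (a i • e)) : MvPolynomial (Fin r) ℤ) :
      MvPowerSeries (Fin r) ℤ) * F ∈ polynomialSubring (Fin r) ℤ)
    (hpos : ∀ k, 0 ≤ PowerSeries.coeff k (raySeries α e F)) (A : ℕ)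
    (hA : ∀ n : ℕ, ((n : ℤ) + 1) ^ m ≤
      ∑ k ∈ Finset.range (A * n + 1), PowerSeries.coeff k (raySeries α e F))
    {B : MvPolynomial (Fin r) ℤ}
    (hB : (B : MvPowerSeries (Fin r) ℤ) * F ∈ polynomialSubring (Fin r) ℤ) :
    phiVec e ^ m ∣ B := by
  rw [prod_one_sub_tpow_nsmul] at hpoly
  set q : Polynomial ℤ := ∏ i, (1 - Polynomial.X ^ a i) with hq
  obtain ⟨p, hp : (p : MvPowerSeries (Fin r) ℤ) = _⟩ := hpoly
  obtain ⟨C, hC : (C : MvPowerSeries (Fin r) ℤ) = _⟩ := hB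
  obtain ⟨P, rfl⟩ := exists_eq_tpow_mul_aeval (hp ▸ hF.aeval_mul q)
  have hP : P.eval 1 ≠ 0 := by
    refine eval_one_ne_zero_of_growth hm ha hpos ?_ A hA
    rw [← hq, ← raySeries_aeval_mul he hF, ← hp, mul_comm, MvPolynomial.coe_mul,
      raySeries_aeval_mul he supportedOnRay_tpow, raySeries_tpow he, mul_one]
  have heq : B * (tpow α * Polynomial.aeval (tpow e) P) = Polynomial.aeval (tpow e) q * C := by
    rw [← MvPolynomial.coe_inj, MvPolynomial.coe_mul, hp, MvPolynomial.coe_mul, hC]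
    ring
  have hdvd : phiVec e ^ m ∣ B * (tpow α * Polynomial.aeval (tpow e) P) := by
    rw [heq, hq, ← prod_one_sub_tpow_nsmul]
    exact (phiVec_pow_dvd_prod_one_sub_tpow he a).mul_right C
  refine IsRelPrime.dvd_of_dvd_mul_right ?_ hdvd
  exact ((isRelPrime_tpow (constantCoeff_phiVec e) α).mul_right
    (isRelPrime_phiVec_aeval he hP)).pow_left

end Ray

section Dimension

theorem ringKrullDim_le_quotient_ker_of_finite {A S : Type*} [CommRing A] [CommRing S] (g : A →+* S)
    (hg : g.Finite) : ringKrullDim S ≤ ringKrullDim (A ⧸ RingHom.ker g) := by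
  rw [ringKrullDim_quotient]
  algebraize [g]
  have : Algebra.IsIntegral A S := Algebra.IsIntegral.of_finite A S
  refine Order.krullDim_le_of_strictMono
    (fun q => ⟨PrimeSpectrum.comap g q, fun a ha => ?_⟩) fun p q hpq => ?_
  · have hga : g a = 0 := ha
    simp [hga]
  · exact Ideal.IsIntegral.comap_lt_comap (R := A) (I := p.asIdeal) (J := q.asIdeal) hpq

theorem injective_of_finite_of_le_ringKrullDim {K S : Type*} [Field K] [CommRing S] {m : ℕ}
    (g : MvPolynomial (Fin m) K →+* S) (hg : g.Finite) (hm : (m : WithBot ℕ∞) ≤ ringKrullDim S) :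
    Function.Injective g := by
  refine (injective_iff_map_eq_zero g).mpr fun p hp => ?_
  by_contra hp0
  have hker := ringKrullDim_succ_le_of_surjective (Ideal.Quotient.mk (RingHom.ker g))
    Ideal.Quotient.mk_surjective (mem_nonZeroDivisors_of_ne_zero hp0)
    (Ideal.Quotient.eq_zero_iff_mem.mpr hp)
  rw [MvPolynomial.ringKrullDim_of_isNoetherianRing, ringKrullDim_eq_zero_of_field] at hker
  have hlt : ((m + 1 : ℕ) : WithBot ℕ∞) ≤ m := calc
    ((m + 1 : ℕ) : WithBot ℕ∞) = m + 1 := by push_cast; rfl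
    _ ≤ ringKrullDim (MvPolynomial (Fin m) K ⧸ RingHom.ker g) + 1 :=
      add_le_add_left (hm.trans (ringKrullDim_le_quotient_ker_of_finite g hg)) 1
    _ ≤ m := hker.trans (by simp)
  exact Nat.not_succ_le_self m (by exact_mod_cast hlt)

theorem ringHom_finite_of_range_le {A A' B : Type*} [CommRing A] [CommRing A'] [CommRing B]
    {g : A →+* B} {h : A' →+* B} (hg : g.Finite) (hle : g.range ≤ h.range) : h.Finite := by
  have hsub : h.range.subtype.Finite :=
    RingHom.Finite.of_comp_finite (f := g.codRestrict h.range fun a => hle ⟨a, rfl⟩) hg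
  exact hsub.comp (RingHom.Finite.of_surjective _ h.rangeRestrict_surjective)

variable {R M : Type*} [CommRing R] [AddCommGroup M] [Module R M]

theorem finsetInf_ker_toSpanSingleton_le_annihilator {T : Finset M}
    (hT : Submodule.span R (T : Set M) = ⊤) :
    T.inf (fun x => LinearMap.ker (LinearMap.toSpanSingleton R M x)) ≤
      Module.annihilator R M := by
  intro a ha
  have hsmul : a • (LinearMap.id : M →ₗ[R] M) = 0 := LinearMap.ext_on hT fun x hx => by
    simpa using Submodule.mem_finsetInf.mp ha x hx
  exact Module.mem_annihilator.mpr fun x => LinearMap.congr_fun hsmul x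

theorem ringKrullDim_quotient_mono_of_le_head {I J : Ideal R}
    (l : LTSeries (PrimeSpectrum.zeroLocus (I : Set R))) (hJ : J ≤ l.head.1.asIdeal) :
    (l.length : WithBot ℕ∞) ≤ ringKrullDim (R ⧸ J) := by
  rw [ringKrullDim_quotient]
  exact Order.le_krullDim_iff.mpr ⟨LTSeries.mk l.length
    (fun i => ⟨(l i).1, hJ.trans (l.head_le i : l.head.1.asIdeal ≤ (l i).1.asIdeal)⟩)
    fun _ _ hij => l.strictMono hij, rfl⟩

theorem exists_mem_le_ringKrullDim {T : Set M} (hT : T.Finite) (hspan : Submodule.span R T = ⊤)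
    (I : Ideal R) {m : ℕ}
    (hm : (m : WithBot ℕ∞) ≤ ringKrullDim (R ⧸ (Module.annihilator R M ⊔ I))) :
    ∃ x ∈ T, (m : WithBot ℕ∞) ≤
      ringKrullDim (R ⧸ (LinearMap.ker (LinearMap.toSpanSingleton R M x) ⊔ I)) := by
  lift T to Finset M using hT
  rw [ringKrullDim_quotient] at hm
  obtain ⟨l, rfl⟩ := Order.le_krullDim_iff.mp hm
  have hhead : Module.annihilator R M ⊔ I ≤ l.head.1.asIdeal := l.head.2
  obtain ⟨x, hx, hxl⟩ := l.head.1.isPrime.inf_le'.mp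
    ((finsetInf_ker_toSpanSingleton_le_annihilator hspan).trans (le_sup_left.trans hhead))
  exact ⟨x, hx, ringKrullDim_quotient_mono_of_le_head l (sup_le hxl (le_sup_right.trans hhead))⟩

end Dimension

section Cyclic

variable {K R M : Type*} [Field K] [CommRing R] [Algebra K R] [AddCommGroup M] [Module R M]

theorem smul_mem_smul_span_singleton_iff {I : Ideal R} {x : M} {a : R} :
    a • x ∈ I • Submodule.span R {x} ↔
      a ∈ LinearMap.ker (LinearMap.toSpanSingleton R M x) ⊔ I := by
  rw [Submodule.mem_smul_span_singleton, Submodule.mem_sup]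
  constructor
  · rintro ⟨b, hb, hbx⟩
    exact ⟨a - b, by simp [sub_smul, hbx], b, hb, sub_add_cancel a b⟩
  · rintro ⟨b, hb, c, hc, rfl⟩
    have hbx : b • x = 0 := hb
    exact ⟨c, hc, by rw [add_smul, hbx, zero_add]⟩

theorem finite_quotient_ker_toSpanSingleton_sup {A : Type*} [CommRing A] [Algebra A R] [Module A M]
    [IsScalarTower A R M] [IsNoetherian A M] (I : Ideal R) (x : M) :
    Module.Finite A (R ⧸ (LinearMap.ker (LinearMap.toSpanSingleton R M x) ⊔ I)) := by
  set g := LinearMap.toSpanSingleton R M x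
  let π : LinearMap.range g →ₗ[R] R ⧸ (LinearMap.ker g ⊔ I) :=
    Submodule.factor le_sup_left ∘ₗ g.quotKerEquivRange.symm.toLinearMap
  have hπ : Function.Surjective π :=
    (Submodule.factor_surjective le_sup_left).comp g.quotKerEquivRange.symm.surjective
  have : IsNoetherian A (LinearMap.range g) :=
    isNoetherian_of_injective ((LinearMap.range g).subtype.restrictScalars A)
      Subtype.val_injective
  exact Module.Finite.of_surjective (π.restrictScalars A) hπ

theorem finite_aeval_quotient {ι κ : Type*} [Finite ι] [Finite κ] {f : ι → R} {g : κ → R}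
    [Module.Finite (Algebra.adjoin K (Set.range (Sum.elim f g))) M] {I : Ideal R}
    (hg : ∀ j, g j ∈ I) (x : M) :
    (MvPolynomial.aeval (R := K) fun i => Ideal.Quotient.mk
      (LinearMap.ker (LinearMap.toSpanSingleton R M x) ⊔ I) (f i)).toRingHom.Finite := by
  set 𝔟 := LinearMap.ker (LinearMap.toSpanSingleton R M x) ⊔ I
  set φ := MvPolynomial.aeval (R := K) fun i => Ideal.Quotient.mk 𝔟 (f i) with hφ
  set A := Algebra.adjoin K (Set.range (Sum.elim f g))
  have : IsNoetherian A M := isNoetherian_adjoin _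
  have hfin : Module.Finite A (R ⧸ 𝔟) := finite_quotient_ker_toSpanSingleton_sup I x
  have hle : A ≤ φ.range.comap (Ideal.Quotient.mkₐ K 𝔟) := by
    refine Algebra.adjoin_le ?_
    rintro _ ⟨i | j, rfl⟩
    · exact ⟨MvPolynomial.X i, by simp [hφ]⟩
    · refine ⟨0, ?_⟩
      rw [map_zero]
      exact (Ideal.Quotient.eq_zero_iff_mem.mpr (Submodule.mem_sup_right (hg j))).symm
  refine ringHom_finite_of_range_le (RingHom.finite_algebraMap.mpr hfin) ?_
  rintro _ ⟨a, rfl⟩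
  exact hle a.2

theorem linearIndependent_mkQ_aeval_monomial_smul [Module K M] [IsScalarTower K R M] {ι : Type*}
    {f : ι → R} {I : Ideal R} {x : M}
    (hinj : Function.Injective (MvPolynomial.aeval (R := K) fun i => Ideal.Quotient.mk
      (LinearMap.ker (LinearMap.toSpanSingleton R M x) ⊔ I) (f i))) :
    LinearIndependent K fun a : ι →₀ ℕ => (I • Submodule.span R {x}).mkQ
      (MvPolynomial.aeval f (MvPolynomial.monomial a (1 : K)) • x) := by
  let ψ : MvPolynomial ι K →ₗ[K] M ⧸ I • Submodule.span R {x} :=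
    ((Submodule.mkQ _ ∘ₗ LinearMap.toSpanSingleton R M x).restrictScalars K) ∘ₗ
      (MvPolynomial.aeval f).toLinearMap
  have hker : LinearMap.ker ψ = ⊥ := by
    refine LinearMap.ker_eq_bot'.mpr fun p hp => hinj ?_
    have hmem : MvPolynomial.aeval f p • x ∈ I • Submodule.span R {x} :=
      (Submodule.Quotient.mk_eq_zero _).mp hp
    have hcomp : (MvPolynomial.aeval (R := K) fun i => Ideal.Quotient.mk
        (LinearMap.ker (LinearMap.toSpanSingleton R M x) ⊔ I) (f i)) =
        (Ideal.Quotient.mkₐ K _).comp (MvPolynomial.aeval f) := by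
      ext i
      simp
    rw [map_zero, hcomp]
    exact Ideal.Quotient.eq_zero_iff_mem.mpr (smul_mem_smul_span_singleton_iff.mp hmem)
  have hlin := (MvPolynomial.basisMonomials ι K).linearIndependent.map' ψ hker
  rw [MvPolynomial.coe_basisMonomials] at hlin
  exact hlin

end Cyclic

section Monomial

theorem aeval_monomial_mem {K R ι σ : Type*} [CommSemiring K] [CommSemiring R] [Algebra K R]
    [AddCommMonoid σ] [Fintype ι] (𝒜 : σ → Submodule K R) [SetLike.GradedMonoid 𝒜] {f : ι → R}
    {δ : ι → σ} (hf : ∀ i, f i ∈ 𝒜 (δ i)) (a : ι →₀ ℕ) (c : K) :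
    MvPolynomial.aeval f (MvPolynomial.monomial a c) ∈ 𝒜 (∑ i, a i • δ i) := by
  rw [MvPolynomial.aeval_monomial, Finsupp.prod_fintype _ _ fun _ => pow_zero _,
    ← Algebra.smul_def]
  exact (𝒜 _).smul_mem c (SetLike.prod_mem_graded (A := 𝒜) (F := Finset.univ)
    (fun i => a i • δ i) (fun i => f i ^ a i) fun i _ => SetLike.pow_mem_graded _ (hf i))

theorem pow_le_sum_of_card_le {m : ℕ} {k : Fin m → ℕ} {h : ℕ → ℤ}
    (hh : ∀ (κ : ℕ) (S : Finset (Fin m → ℕ)), (∀ a ∈ S, ∑ i, a i * k i = κ) → (S.card : ℤ) ≤ h κ)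
    (n : ℕ) : ((n : ℤ) + 1) ^ m ≤ ∑ κ ∈ Finset.range ((∑ i, k i) * n + 1), h κ := by
  set box : Finset (Fin m → ℕ) := Fintype.piFinset fun _ => Finset.range (n + 1) with hbox
  have hdeg : ∀ a ∈ box, ∑ i, a i * k i ∈ Finset.range ((∑ i, k i) * n + 1) := fun a ha => by
    rw [Finset.mem_range, Nat.lt_succ_iff, Finset.sum_mul]
    refine Finset.sum_le_sum fun i _ => ?_
    rw [mul_comm]
    exact Nat.mul_le_mul_left _
      (Nat.lt_succ_iff.mp (Finset.mem_range.mp (Fintype.mem_piFinset.mp ha i)))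
  calc ((n : ℤ) + 1) ^ m = (box.card : ℤ) := by simp [hbox]
    _ = ∑ κ ∈ Finset.range ((∑ i, k i) * n + 1),
        ((box.filter fun a => ∑ i, a i * k i = κ).card : ℤ) := by
      exact_mod_cast Finset.card_eq_sum_card_fiberwise hdeg
    _ ≤ _ := Finset.sum_le_sum fun κ _ => hh κ _ fun a ha => (Finset.mem_filter.mp ha).2

end Monomial

section LowerBound

variable {K R M : Type*} [Field K] [CommRing R] [Algebra K R] [AddCommGroup M] [Module K M]
  [Module R M] [IsScalarTower K R M] {r : ℕ}
  {𝒜 : (Fin r → ℕ) → Submodule K R} {ℳ : (Fin r → ℤ) → Submodule K M}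

/-- `B` clears the denominators of the Hilbert series of all graded submodules of `M`. In contrast
to `IsCommonDenominator`, the normalization `B(0) = 1` is left out and the Hilbert series are
replaced by the power series `t^{-c} H(N,t)`. -/
def ClearsDenominators (R : Type*) [CommRing R] [Algebra K R] [Module R M] [IsScalarTower K R M]
    (c : Fin r → ℤ) (ℳ : (Fin r → ℤ) → Submodule K M) [DirectSum.Decomposition ℳ]
    (B : MvPolynomial (Fin r) ℤ) : Prop :=
  ∀ N : Submodule R M, N.IsHomogeneous ℳ →
    (B : MvPowerSeries (Fin r) ℤ) * hilbertPowerSeries c ℳ N ∈ polynomialSubring (Fin r) ℤ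

theorem coeff_hilbertPowerSeries (c : Fin r → ℤ) (N : Submodule R M) (a : Fin r →₀ ℕ) :
    MvPowerSeries.coeff a (hilbertPowerSeries c ℳ N) = hilbertSeries ℳ N (⇑a +ᵥ c) := rfl

theorem card_le_hilbertSeries_sub [SetLike.GradedMonoid 𝒜] [SetLike.GradedSMul 𝒜 ℳ]
    [∀ d, FiniteDimensional K (ℳ d)] {ι : Type*} [Fintype ι] {f : ι → R} {δ : ι → Fin r → ℕ}
    (hf : ∀ i, f i ∈ 𝒜 (δ i)) {I : Ideal R} {x : M} {d d' : Fin r → ℤ} (hx : x ∈ ℳ d)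
    (hinj : Function.Injective (MvPolynomial.aeval (R := K) fun i => Ideal.Quotient.mk
      (LinearMap.ker (LinearMap.toSpanSingleton R M x) ⊔ I) (f i)))
    {S : Finset (ι → ℕ)} (hS : ∀ a ∈ S, (∑ i, a i • δ i) +ᵥ d = d') :
    (S.card : ℤ) ≤ hilbertSeries ℳ (Submodule.span R {x}) d' -
      hilbertSeries ℳ (I • Submodule.span R {x}) d' := by
  rw [hilbertSeries_eq_add (Submodule.smul_le_right : I • Submodule.span R {x} ≤ _) d',
    add_sub_cancel_left]
  have : FiniteDimensional K ↥((Submodule.span R {x}).restrictScalars K ⊓ ℳ d') :=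
    Submodule.finiteDimensional_of_le inf_le_right
  have hlin := (linearIndependent_mkQ_aeval_monomial_smul hinj).comp
    (fun a : S => Finsupp.equivFunOnFinite.symm a.1)
    (Finsupp.equivFunOnFinite.symm.injective.comp Subtype.val_injective)
  rw [← Fintype.card_coe, ← finrank_span_eq_card hlin, Nat.cast_le]
  refine Submodule.finrank_mono (Submodule.span_le.mpr ?_)
  rintro _ ⟨a, rfl⟩
  refine Submodule.mem_map_of_mem (f := (Submodule.mkQ _).restrictScalars K)
    ⟨Submodule.smul_mem _ _ (Submodule.mem_span_singleton_self x), ?_⟩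
  exact hS a a.2 ▸ SetLike.GradedSMul.smul_mem (aeval_monomial_mem 𝒜 hf
    (Finsupp.equivFunOnFinite.symm a.1) 1) hx

theorem card_le_coeff_raySeries_hilbertPowerSeries_sub [SetLike.GradedMonoid 𝒜]
    [SetLike.GradedSMul 𝒜 ℳ] [∀ d, FiniteDimensional K (ℳ d)]
    {c : Fin r → ℤ} {α e : Fin r → ℕ} {m : ℕ} {f : Fin m → R} {k : Fin m → ℕ}
    (hf : ∀ i, f i ∈ 𝒜 (k i • e)) {x : M} (hx : x ∈ ℳ (α +ᵥ c))
    (hinj : Function.Injective (MvPolynomial.aeval (R := K) fun i => Ideal.Quotient.mk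
      (LinearMap.ker (LinearMap.toSpanSingleton R M x) ⊔ idealI 𝒜 e) (f i)))
    {κ : ℕ} {S : Finset (Fin m → ℕ)} (hS : ∀ a ∈ S, ∑ i, a i * k i = κ) :
    (S.card : ℤ) ≤ PowerSeries.coeff κ (raySeries α e
      (hilbertPowerSeries c ℳ (Submodule.span R {x}) -
        hilbertPowerSeries c ℳ (idealI 𝒜 e • Submodule.span R {x}))) := by
  rw [raySeries, PowerSeries.coeff_mk, map_sub, coeff_hilbertPowerSeries, coeff_hilbertPowerSeries]
  refine card_le_hilbertSeries_sub hf hx hinj fun a ha => ?_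
  rw [vadd_vadd, Finsupp.coe_equivFunOnFinite_symm, add_comm, ← hS a ha, Finset.sum_smul]
  simp only [mul_smul]

variable [DirectSum.Decomposition ℳ]

section Ray

variable [GradedAlgebra 𝒜] [SetLike.GradedSMul 𝒜 ℳ]

theorem isHomogeneous_idealI_smul_span_singleton (e : Fin r → ℕ) {x : M} {d : Fin r → ℤ}
    (hx : x ∈ ℳ d) : (idealI 𝒜 e • Submodule.span R {x}).IsHomogeneous ℳ := by
  rw [idealI, Submodule.span_smul_span]
  refine isHomogeneous_span 𝒜 fun y hy => ?_
  obtain ⟨a, ⟨δ, -, ha⟩, z, rfl, rfl⟩ := Set.mem_smul.mp hy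
  exact ⟨_, SetLike.GradedSMul.smul_mem ha hx⟩

omit [IsScalarTower K R M] in
theorem proj_smul_mem_idealI_smul_span_singleton {e : Fin r → ℕ} {x : M} {d d' : Fin r → ℤ}
    (hx : x ∈ ℳ d) (h : ∀ k : ℕ, k • e +ᵥ d ≠ d') (b : R) :
    proj ℳ d' (b • x) ∈ idealI 𝒜 e • Submodule.span R {x} := by
  induction b using DirectSum.Decomposition.inductionOn 𝒜 with
  | zero => simp
  | @homogeneous δ b =>
    have hbx : (b : R) • x ∈ ℳ (δ +ᵥ d) := SetLike.GradedSMul.smul_mem b.2 hx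
    by_cases hd : δ +ᵥ d = d'
    · rw [proj_of_mem ℳ (hd ▸ hbx)]
      refine Submodule.smul_mem_smul (mem_idealI 𝒜 ?_ b.2) (Submodule.mem_span_singleton_self x)
      rintro ⟨k, rfl⟩
      exact h k hd
    · rw [proj_of_mem_of_ne ℳ hbx hd]
      exact zero_mem _
  | add a b ha hb => rw [add_smul, map_add]; exact add_mem ha hb

theorem hilbertSeries_span_singleton_eq {e : Fin r → ℕ} {x : M} {d d' : Fin r → ℤ} (hx : x ∈ ℳ d)
    (h : ∀ k : ℕ, k • e +ᵥ d ≠ d') : hilbertSeries ℳ (Submodule.span R {x}) d' =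
      hilbertSeries ℳ (idealI 𝒜 e • Submodule.span R {x}) d' := by
  have heq : (Submodule.span R {x}).restrictScalars K ⊓ ℳ d' =
      (idealI 𝒜 e • Submodule.span R {x}).restrictScalars K ⊓ ℳ d' := by
    refine le_antisymm ?_ (inf_le_inf_right _
      (Submodule.smul_le_right : idealI 𝒜 e • Submodule.span R {x} ≤ Submodule.span R {x}))
    rintro y ⟨hy, hyd⟩
    obtain ⟨b, rfl⟩ := Submodule.mem_span_singleton.mp hy
    refine ⟨?_, hyd⟩
    rw [← proj_of_mem ℳ hyd]
    exact proj_smul_mem_idealI_smul_span_singleton hx h b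
  rw [hilbertSeries, hilbertSeries, heq]

theorem supportedOnRay_hilbertPowerSeries_sub {c : Fin r → ℤ} {α : Fin r → ℕ} (e : Fin r → ℕ)
    {x : M} (hx : x ∈ ℳ (α +ᵥ c)) :
    SupportedOnRay α e (hilbertPowerSeries c ℳ (Submodule.span R {x}) -
      hilbertPowerSeries c ℳ (idealI 𝒜 e • Submodule.span R {x})) := by
  intro a ha
  by_contra! hne
  refine ha ?_
  rw [map_sub, coeff_hilbertPowerSeries, coeff_hilbertPowerSeries, sub_eq_zero]
  refine hilbertSeries_span_singleton_eq hx fun k hk => hne k ?_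
  rw [vadd_vadd, add_comm] at hk
  exact (Finsupp.equivFunOnFinite.symm_apply_eq.mpr (natVec_vadd_right_cancel hk)).symm

end Ray

omit [IsScalarTower K R M] in
theorem exists_homogeneous_mult_le_ringKrullDim [Algebra.FiniteType K R] [Module.Finite R M]
    (𝒜 : (Fin r → ℕ) → Submodule K R) (ℳ : (Fin r → ℤ) → Submodule K M)
    [DirectSum.Decomposition ℳ] {e : Fin r → ℕ} (he : mult 𝒜 M e ≠ 0) :
    ∃ (d : Fin r → ℤ), ∃ x ∈ ℳ d, x ≠ 0 ∧ (mult 𝒜 M e : WithBot ℕ∞) ≤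
      ringKrullDim (R ⧸ (LinearMap.ker (LinearMap.toSpanSingleton R M x) ⊔ idealI 𝒜 e)) := by
  obtain ⟨T, hT, hhom, hspan⟩ := exists_finite_homogeneous_generators ℳ R
  have hbot : suppDim 𝒜 M e ≠ ⊥ := fun h => he (by rw [mult, h]; rfl)
  have hdim : (mult 𝒜 M e : WithBot ℕ∞) ≤
      ringKrullDim (R ⧸ (Module.annihilator R M ⊔ idealI 𝒜 e)) :=
    ((suppDim_eq_mult 𝒜 hbot).symm.trans (suppDim_eq 𝒜 e)).le
  obtain ⟨x, hxT, hx⟩ := exists_mem_le_ringKrullDim hT hspan (idealI 𝒜 e) hdim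
  obtain ⟨d, hxd⟩ := hhom x hxT
  refine ⟨d, x, hxd, ?_, hx⟩
  rintro rfl
  have : Subsingleton (R ⧸ (LinearMap.ker (LinearMap.toSpanSingleton R M 0) ⊔ idealI 𝒜 e)) := by
    rw [Ideal.Quotient.subsingleton_iff, LinearMap.toSpanSingleton_zero, LinearMap.ker_zero,
      top_sup_eq]
  rw [ringKrullDim_eq_bot_of_subsingleton, le_bot_iff] at hx
  exact WithBot.coe_ne_bot hx

theorem ClearsDenominators.phiVec_pow_mult_dvd [GradedAlgebra 𝒜] [SetLike.GradedSMul 𝒜 ℳ]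
    [Algebra.FiniteType K R] [FiniteDimensional K (𝒜 0)] [Module.Finite R M]
    [∀ d, FiniteDimensional K (ℳ d)] {c : Fin r → ℤ} (hc : ∀ d, ℳ d ≠ ⊥ → c ≤ d)
    {B : MvPolynomial (Fin r) ℤ} (hB : ClearsDenominators R c ℳ B) (e : Fin r → ℕ) :
    phiVec e ^ mult 𝒜 M e ∣ B := by
  obtain hm | hm := eq_or_ne (mult 𝒜 M e) 0
  · rw [hm, pow_zero]
    exact one_dvd B
  have he : e ≠ 0 := by
    rintro rfl
    exact hm (mult_zero 𝒜)
  obtain ⟨G, f, k, η, hk, hη, hfG, hδ, _⟩ := exists_parameters_of_mult M 𝒜 e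
  have := finite_adjoin ℳ hfG hδ
  have hGI : ∀ g : G, (g : R) ∈ idealI 𝒜 e := fun g => mem_idealI 𝒜 (hη g) (hfG (.inr g))
  obtain ⟨d, x, hxd, hx0, hdim⟩ := exists_homogeneous_mult_le_ringKrullDim 𝒜 ℳ hm
  have hinj := injective_of_finite_of_le_ringKrullDim _
    (finite_aeval_quotient (K := K) (f := f) hGI x) hdim
  obtain ⟨α, rfl⟩ := exists_natVec_vadd_eq (hc d fun h => hx0 (by simpa [h] using hxd))
  have hN : (Submodule.span R {x}).IsHomogeneous ℳ :=
    isHomogeneous_span 𝒜 (by rintro _ rfl; exact ⟨_, hxd⟩)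
  have hN' := isHomogeneous_idealI_smul_span_singleton (𝒜 := 𝒜) e hxd
  have hcard := fun (κ : ℕ) (S : Finset (Fin (mult 𝒜 M e) → ℕ)) =>
    card_le_coeff_raySeries_hilbertPowerSeries_sub (κ := κ) (S := S)
      (fun i => hfG (.inl i)) hxd hinj
  refine phiVec_pow_dvd_of_growth he (supportedOnRay_hilbertPowerSeries_sub e hxd) hm hk ?_
    (fun κ => by simpa using hcard κ ∅) _ (pow_le_sum_of_card_le hcard) ?_
  · have := prod_mul_hilbertPowerSeries_sub_mem_polynomialSubring hc hfG (Finset.univ.map .inl)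
      hN hN' Submodule.smul_le_right (Sum.forall.mpr ⟨fun i hi => by simp at hi, fun g _ y hy =>
        Submodule.smul_mem_smul (hGI g) hy⟩)
    rwa [Finset.prod_map] at this
  · rw [mul_sub]
    exact sub_mem (hB _ hN) (hB _ hN')

end LowerBound

section UniversalDenominator

variable {K R M : Type*} [Field K] [CommRing R] [Algebra K R] [AddCommGroup M] [Module K M]
  [Module R M] [IsScalarTower K R M] {r : ℕ}
  {𝒜 : (Fin r → ℕ) → Submodule K R} {ℳ : (Fin r → ℤ) → Submodule K M}

omit [Module K M] [IsScalarTower K R M] in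
theorem prod_mem_parameterProducts {ι : Type*} [Fintype ι] {f : ι → R} {δ : ι → Fin r → ℕ}
    (hf : ∀ i, f i ∈ 𝒜 (δ i)) [hfin : Module.Finite (Algebra.adjoin K (Set.range f)) M] :
    ∏ i, (1 - tpow (δ i)) ∈ parameterProducts 𝒜 M := by
  let E := (Fintype.equivFin ι).symm
  refine ⟨Fintype.card ι, f ∘ E, δ ∘ E, fun i => hf (E i), ?_, ?_⟩
  · rwa [E.surjective.range_comp]
  · exact (E.prod_comp fun i => 1 - tpow (δ i)).symm

theorem hilbertPowerSeries_bot (c : Fin r → ℤ) :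
    hilbertPowerSeries c ℳ (⊥ : Submodule R M) = 0 := by
  ext a
  rw [coeff_hilbertPowerSeries, hilbertSeries, Submodule.restrictScalars_bot, bot_inf_eq,
    finrank_bot, Nat.cast_zero, map_zero]

variable [DirectSum.Decomposition ℳ]

theorem IsUniversalDenominator.udenom_eq {B : MvPolynomial (Fin r) ℤ}
    (h : IsUniversalDenominator R ℳ B) : udenom R ℳ = B := by
  have hex : ∃ B, IsUniversalDenominator R ℳ B := ⟨B, h⟩
  have hU : IsUniversalDenominator R ℳ (udenom R ℳ) := by
    rw [udenom, dif_pos hex]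
    exact hex.choose_spec
  exact eq_of_dvd_of_dvd_of_constantCoeff hU.1.1 h.1.1 (hU.2 B h.1) (h.2 _ hU.1)

theorem ClearsDenominators.of_dvd {c : Fin r → ℤ} {B B' : MvPolynomial (Fin r) ℤ}
    (hB : ClearsDenominators R c ℳ B) (h : B ∣ B') : ClearsDenominators R c ℳ B' := by
  obtain ⟨A, rfl⟩ := h
  intro N hN
  rw [MvPolynomial.coe_mul, mul_comm (B : MvPowerSeries (Fin r) ℤ), mul_assoc]
  exact mul_mem (coe_mem_polynomialSubring A) (hB N hN)

theorem ClearsDenominators.phiProd_inf {c : Fin r → ℤ} {n n' : (Fin r → ℕ) →₀ ℕ}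
    (h : ClearsDenominators R c ℳ (phiProd n)) (h' : ClearsDenominators R c ℳ (phiProd n')) :
    ClearsDenominators R c ℳ (phiProd (n ⊓ n')) := by
  rw [phiProd_eq_inf_mul_left n n'] at h
  rw [phiProd_eq_inf_mul_right n n'] at h'
  exact fun N hN => coe_mul_mem_polynomialSubring_of_isRelPrime (phiProd_ne_zero _)
    (isRelPrime_phiProd_sub_inf n n') (h N hN) (h' N hN)

theorem isCommonDenominator_iff {c : Fin r → ℤ} (hc : ∀ d, ℳ d ≠ ⊥ → c ≤ d)
    (B : MvPolynomial (Fin r) ℤ) : IsCommonDenominator R ℳ B ↔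
      MvPolynomial.constantCoeff B = 1 ∧ ClearsDenominators R c ℳ B :=
  and_congr_right fun _ => forall₂_congr fun N _ =>
    isLaurentPolynomial_polyMul_iff (le_of_hilbertSeries_ne_zero hc N) B

theorem clearsDenominators_of_mem_parameterProducts [SetLike.GradedSMul 𝒜 ℳ]
    [∀ d, FiniteDimensional K (ℳ d)] {c : Fin r → ℤ} (hc : ∀ d, ℳ d ≠ ⊥ → c ≤ d)
    {p : MvPolynomial (Fin r) ℤ} (hp : p ∈ parameterProducts 𝒜 M) :
    ClearsDenominators R c ℳ p := by
  obtain ⟨s, f, δ, hf, _, rfl⟩ := hp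
  intro N hN
  have hbot : (⊥ : Submodule R M).IsHomogeneous ℳ := fun d x hx => by
    rw [(Submodule.mem_bot R).mp hx, DirectSum.decompose_zero]
    exact zero_mem _
  have := prod_mul_hilbertPowerSeries_sub_mem_polynomialSubring hc hf Finset.univ hN
    hbot bot_le fun i hi => absurd (Finset.mem_univ i) hi
  rwa [hilbertPowerSeries_bot, sub_zero] at this

section MultFinsupp

variable [GradedAlgebra 𝒜] [Algebra.FiniteType K R] [FiniteDimensional K (𝒜 0)]
  [Module.Finite R M]

variable (M 𝒜) in
/-- The exponents `m_e` as a finitely supported function of `e`. -/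
noncomputable def multFinsupp : (Fin r → ℕ) →₀ ℕ :=
  Finsupp.ofSupportFinite (mult 𝒜 M) (finite_setOf_mult_ne_zero M 𝒜)

omit [Module K M] [IsScalarTower K R M] in
theorem phiProd_multFinsupp_eq_finprod :
    phiProd (multFinsupp M 𝒜) = ∏ᶠ d, phiVec d ^ mult 𝒜 M d := by
  refine (finprod_eq_prod_of_mulSupport_subset _ fun d hd => ?_).symm
  rw [Finset.mem_coe, Finsupp.mem_support_iff]
  exact fun h => hd ((congrArg (phiVec d ^ ·) h).trans (pow_zero _))

end MultFinsupp

variable [GradedAlgebra 𝒜] [SetLike.GradedSMul 𝒜 ℳ] [Module.Finite R M]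

variable (ℳ)
include ℳ

theorem phiProd_mem_parameterProducts {ι : Type*} [Fintype ι] {f : ι → R} {δ : ι → Fin r → ℕ}
    (hf : ∀ i, f i ∈ 𝒜 (δ i)) (hδ : ∀ i, δ i ≠ 0)
    [Module.Finite K (R ⧸ (Module.annihilator R M ⊔ Ideal.span (Set.range f)))] :
    phiProd (∑ i, divisorIndicator (δ i)) ∈ parameterProducts 𝒜 M := by
  have := finite_adjoin ℳ hf hδ
  rw [phiProd_sum, Finset.prod_congr rfl fun i _ => phiProd_divisorIndicator (hδ i)]
  exact prod_mem_parameterProducts hf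

variable [Algebra.FiniteType K R] [FiniteDimensional K (𝒜 0)]

theorem exists_phiProd_mem_parameterProducts_apply_le_mult (e : Fin r → ℕ) :
    ∃ n : (Fin r → ℕ) →₀ ℕ, phiProd n ∈ parameterProducts 𝒜 M ∧ n e ≤ mult 𝒜 M e := by
  obtain ⟨G, f, k, η, _, hη, hfG, hδ, _⟩ := exists_parameters_of_mult M 𝒜 e
  refine ⟨_, phiProd_mem_parameterProducts ℳ hfG hδ, ?_⟩
  simp only [Fintype.sum_sum_type, Finsupp.add_apply, Finsupp.finsetSum_apply, Sum.elim_inl,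
    Sum.elim_inr]
  rw [Finset.sum_eq_zero fun g _ => divisorIndicator_eq_zero (hη g), add_zero]
  refine (Finset.sum_le_card_nsmul _ _ 1
    fun i _ => divisorIndicator_le_one (hδ (.inl i)) e).trans ?_
  rw [Finset.card_fin, smul_eq_mul, mul_one]

variable (𝒜) in
include 𝒜 in
theorem finiteDimensional_component (d : Fin r → ℤ) : FiniteDimensional K (ℳ d) := by
  obtain ⟨G, η, hη, hG, hfin⟩ := exists_irrelevant_parameters 𝒜
  have := hfin (Module.annihilator R M ⊔ Ideal.span (Set.range ((↑) : G → R))) le_sup_right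
  exact finite_component ℳ hG hη d

variable (𝒜) in
theorem exists_inf'_le_multFinsupp : ∃ (s : Finset (Fin r → ℕ)) (hs : s.Nonempty)
    (n : (Fin r → ℕ) → (Fin r → ℕ) →₀ ℕ),
    (∀ e, phiProd (n e) ∈ parameterProducts 𝒜 M) ∧ s.inf' hs n ≤ multFinsupp M 𝒜 := by
  classical
  choose n hn hle using exists_phiProd_mem_parameterProducts_apply_le_mult ℳ (𝒜 := 𝒜)
  refine ⟨insert 0 (n 0).support, Finset.insert_nonempty _ _, n, hn, fun e => ?_⟩
  by_cases he : e ∈ insert 0 (n 0).support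
  · exact (Finset.inf'_le n he e).trans (hle e)
  · rw [Finset.mem_insert, not_or, Finsupp.notMem_support_iff] at he
    exact (Finset.inf'_le n (Finset.mem_insert_self 0 _) e).trans (he.2.trans_le (Nat.zero_le _))

theorem dvd_phiProd_multFinsupp {C : MvPolynomial (Fin r) ℤ}
    (hC : ∀ p ∈ parameterProducts 𝒜 M, C ∣ p) : C ∣ phiProd (multFinsupp M 𝒜) := by
  obtain ⟨s, hs, n, hn, hle⟩ := exists_inf'_le_multFinsupp 𝒜 ℳ
  refine Dvd.dvd.trans ?_ (phiProd_dvd_phiProd hle)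
  exact Finset.inf'_induction hs n (p := fun n => C ∣ phiProd n)
    (fun _ h _ h' => dvd_phiProd_inf h h') fun e _ => hC _ (hn e)

theorem clearsDenominators_phiProd_multFinsupp [∀ d, FiniteDimensional K (ℳ d)] {c : Fin r → ℤ}
    (hc : ∀ d, ℳ d ≠ ⊥ → c ≤ d) : ClearsDenominators R c ℳ (phiProd (multFinsupp M 𝒜)) := by
  obtain ⟨s, hs, n, hn, hle⟩ := exists_inf'_le_multFinsupp 𝒜 ℳ
  refine ClearsDenominators.of_dvd ?_ (phiProd_dvd_phiProd hle)
  exact Finset.inf'_induction hs n (p := fun n => ClearsDenominators R c ℳ (phiProd n))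
    (fun _ h _ h' => h.phiProd_inf h') fun e _ =>
      clearsDenominators_of_mem_parameterProducts hc (hn e)

theorem ClearsDenominators.phiProd_multFinsupp_dvd [∀ d, FiniteDimensional K (ℳ d)]
    {c : Fin r → ℤ} (hc : ∀ d, ℳ d ≠ ⊥ → c ≤ d) {B : MvPolynomial (Fin r) ℤ}
    (hB : ClearsDenominators R c ℳ B) : phiProd (multFinsupp M 𝒜) ∣ B :=
  phiProd_dvd_of_forall (hB.phiVec_pow_mult_dvd hc)

variable (𝒜) in
theorem isUniversalDenominator_phiProd_multFinsupp :
    IsUniversalDenominator R ℳ (phiProd (multFinsupp M 𝒜)) := by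
  have := finiteDimensional_component 𝒜 ℳ
  obtain ⟨c, hc⟩ := exists_forall_le_of_ne_bot R 𝒜 ℳ
  simp only [IsUniversalDenominator, isCommonDenominator_iff hc]
  exact ⟨⟨constantCoeff_phiProd _, clearsDenominators_phiProd_multFinsupp ℳ hc⟩,
    fun B hB => hB.2.phiProd_multFinsupp_dvd ℳ hc⟩

theorem dvd_phiProd_multFinsupp_iff {C : MvPolynomial (Fin r) ℤ} :
    C ∣ phiProd (multFinsupp M 𝒜) ↔ ∀ p ∈ parameterProducts 𝒜 M, C ∣ p := by
  have := finiteDimensional_component 𝒜 ℳ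
  obtain ⟨c, hc⟩ := exists_forall_le_of_ne_bot R 𝒜 ℳ
  exact ⟨fun hC p hp => hC.trans
    ((clearsDenominators_of_mem_parameterProducts hc hp).phiProd_multFinsupp_dvd ℳ hc),
    dvd_phiProd_multFinsupp ℳ⟩

end UniversalDenominator

end UnivDenom

/-- Let `R` be an `ℕ^r`-graded `K`-algebra of finite type with `R_0` finite-dimensional and `M` a
finitely generated `ℤ^r`-graded `R`-module. The universal denominator of `M` exists, it equals
`∏_d φ_d(t)^{m_d}` (a finite product), and it is the greatest common divisor of all products
`(1 - t^{d₁}) ⋯ (1 - t^{d_s})` attached to homogeneous `f₁, …, f_s` such that `M` is finite over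
`K[f₁, …, f_s]`. -/
theorem mainTheorem1 {K R M : Type*} [Field K] [CommRing R] [Algebra K R]
    [AddCommGroup M] [Module K M] [Module R M] [IsScalarTower K R M] {r : ℕ}
    (𝒜 : (Fin r → ℕ) → Submodule K R) [GradedAlgebra 𝒜]
    [Algebra.FiniteType K R] [FiniteDimensional K (𝒜 0)]
    (ℳ : (Fin r → ℤ) → Submodule K M) [DirectSum.Decomposition ℳ]
    (hsmul : ∀ (e : Fin r → ℕ) (d : Fin r → ℤ), ∀ a ∈ 𝒜 e, ∀ x ∈ ℳ d,
      a • x ∈ ℳ (fun i => (e i : ℤ) + d i))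
    [Module.Finite R M] :
    UnivDenom.IsUniversalDenominator R ℳ (UnivDenom.udenom R ℳ) ∧
    ((∀ d, UnivDenom.suppDim 𝒜 M d ≠ ⊤) ∧
      {d | UnivDenom.mult 𝒜 M d ≠ 0}.Finite ∧
      UnivDenom.udenom R ℳ = ∏ᶠ d, UnivDenom.phiVec d ^ UnivDenom.mult 𝒜 M d) ∧
    ∀ C : MvPolynomial (Fin r) ℤ,
      C ∣ UnivDenom.udenom R ℳ ↔ ∀ p ∈ UnivDenom.parameterProducts 𝒜 M, C ∣ p := by
  have : SetLike.GradedSMul 𝒜 ℳ := ⟨fun _ _ _ _ ha hx => hsmul _ _ _ ha _ hx⟩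
  have hU := UnivDenom.isUniversalDenominator_phiProd_multFinsupp 𝒜 ℳ
  rw [hU.udenom_eq]
  exact ⟨hU, ⟨UnivDenom.suppDim_ne_top 𝒜, UnivDenom.finite_setOf_mult_ne_zero M 𝒜,
    UnivDenom.phiProd_multFinsupp_eq_finprod⟩, fun _ => UnivDenom.dvd_phiProd_multFinsupp_iff ℳ⟩
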